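/- Theorem (the first two computed deflation steps are mixed stable). Let $\mathbb F$ be $\mathbb R$ or $\mathbb C$, $A,B,C,D,E\in\mathbb F^{n\times n}$, and consider the linearization $$\mathbb A-\lambda\mathbb B=\begin{pmatrix}B&0&-I&0\\D&0&0&-I\\0&-I&0&0\\E&0&0&0\end{pmatrix}-\lambda\begin{pmatrix}-A&0&0&0\\-C&-I&0&0\\0&0&-I&0\\0&0&0&-I\end{pmatrix}$$ of $\lambda^4A+\lambda^3B+\lambda^2C+\lambda D+E$. All computations are in floating point arithmetic (standard model: each elementary operation commits a relative error at most $\varepsilon$, sums in any order). "Mildly growing" means nonnegative and bounded by a polynomial in $n$. *First step.* A Householder QR factorization of $E\widetilde\Pi_E$ ($\widetilde\Pi_E$ the permutation from pivoting, by any pivoting strategy) is computed and truncated at the numerical rank $r=\widetilde r_E$: its first $r$ diagonal entries (pivots) are nonzero, and the discarded part (rows $>r$) of each trailing column is at most $\tau$ times each of these $r$ pivots in modulus (if $r=0$, nothing nonzero is discarded). This gives $E\widetilde\Pi_E\approx\widetilde Q_E\binom{\widetilde R_E}{0}$ with computed $\widetilde Q_E$ and an $r\times n$ matrix $\widetilde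 R_E$. Further $\widetilde X=computed(\widetilde Q_E^*D)$, $\widetilde Y=computed(\widetilde Q_E^*C)$, each by explicit multiplication or by successive application of the computed reflectors. An index 1 (resp. 2) denotes the first $r$ (resp. last $n-r$) rows of $\widetilde X$, $\widetilde Y$ and the first $r$ (resp. last $n-r$) columns of $\widetilde Q_E$, $\widehat Q_E$. *Second step.* A Householder QR factorization of $\binom{\widetilde X_2}{\widetilde R_E\widetilde\Pi_E^T}\widetilde\Pi_{A_{22}}$ is computed, with computed factors $\widetilde Q_{A_{22}}$ and $\binom{\widetilde R_{A_{22}}}{0}$, where $\widetilde R_{A_{22}}$ has $\widetilde r_2$ rows and nonzero pivots; what is set to zero in a column of the triangular factor is at most $g(n)\varepsilon$ times the norm of that column, $g$ being a fixed mildly growing function (nothing nonzero is discarded if $g=0$). With $\widetilde Q_{A_{22}}^*=(\widetilde\Omega_1\ \widetilde\Omega_2)$, $\widetilde\Omega_1$ having $n-r$ columns, put $\widetilde N_{[1]}=computed(\widetilde\Omega_1\widetilde Y_2)$, $\widetilde N_{[2]}=computed(\widetilde\Omega_1\widetilde Q_{E,2}^*)$, $\widetilde N_{[3]}=0$, $\widetilde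 N_{[4]}=-\widetilde\Omega_2$. The computed pencil $\widetilde{\mathbb A}-\lambda\widetilde{\mathbb B}$ (block rows of sizes $n,r,n,n$, block columns of sizes $n,n,n,r$) is $$\widetilde{\mathbb A}=\begin{pmatrix}B&0&-I_n&0\\ \widetilde X_1&0&0&-I_r\\0&-I_n&0&0\\ \binom{\widetilde R_{A_{22}}\widetilde\Pi_{A_{22}}^T}{0}&0&0&0\end{pmatrix},\quad \widetilde{\mathbb B}=\begin{pmatrix}-A&0&0&0\\-\widetilde Y_1&-\widetilde Q_{E,1}^*&0&0\\0&0&-I_n&0\\-\widetilde N_{[1]}&-\widetilde N_{[2]}&\widetilde N_{[3]}&\widetilde N_{[4]}\end{pmatrix}.$$ *Claim.* For every $g$ there are mildly growing $f_C,f_D,f_{qr},f_1,f_2,h$, independent of $n,\varepsilon,\tau$, the data and the run, such that whenever $h(n)\varepsilon\le1$ the following holds with $\epsilon_C=f_C(n)\varepsilon$, $\epsilon_D=f_D(n)\varepsilon$, $\epsilon_{qr}=f_{qr}(n)\varepsilon$. There are exactly unitary $\widehat Q_E$, $\widehat Q_{A_{22}}$ with $\|\widetilde Q_E-\widehat Q_E\|_F\le\epsilon_{qr}$,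 $\|\widetilde Q_{A_{22}}-\widehat Q_{A_{22}}\|_F\le\epsilon_{qr}$, and errors such that: 1. $\widetilde X=\widetilde Q_E^*(D+\delta D)=\widehat Q_E^*(D+\Delta D)$ and $\widetilde Y=\widetilde Q_E^*(C+\delta C)=\widehat Q_E^*(C+\Delta C)$, where for every $i$ both $\|\delta C(:,i)\|_2$ and $\|\Delta C(:,i)\|_2$ are at most $\epsilon_C\|C(:,i)\|_2$, and both $\|\delta D(:,i)\|_2$ and $\|\Delta D(:,i)\|_2$ are at most $\epsilon_D\|D(:,i)\|_2$. 2. $(E+\delta E+\Delta E)\widetilde\Pi_E=\widehat Q_E\binom{\widetilde R_E}{0}$ with $\|\delta E(:,i)\|_2\le\epsilon_{qr}\|E(:,i)\|_2$ for every $i$; the first $r$ columns of $\Delta E\,\widetilde\Pi_E$ vanish, and each other column of it has norm at most $\tau\min_{i\le r}\|(E+\delta E)\widetilde\Pi_E(:,i)\|_2$ ($\Delta E=0$ if $r=0$). 3. $\Delta_\Sigma D=\Delta D+\widehat Q_{E,2}\Gamma_1$ and $\Delta_\Sigma E=\delta E+\Delta E+\widehat Q_{E,1}\Gamma_2$, where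 for every $i$ $$\left\|\binom{\Gamma_1}{\Gamma_2}(:,i)\right\|_2\le\epsilon_{qr}\left\|\binom{D+\Delta D}{E+\delta E+\Delta E}(:,i)\right\|_2 .$$ 4. The forward perturbation of $\widetilde{\mathbb B}$ $$\mathcal F=\begin{pmatrix}0&0&0&0\\0&-\delta\widetilde Q_{E,1}^*&0&0\\0&0&0&0\\ \Delta\widetilde N_{[1]}&\Delta\widetilde N_{[2]}&0&\Delta\widetilde N_{[4]}\end{pmatrix}$$ satisfies $\|\delta\widetilde Q_{E,1}^*\|_2\le\epsilon_{qr}$, $\|\Delta\widetilde N_{[4]}\|_2\le\epsilon_{qr}$, $\|\Delta\widetilde N_{[1]}(:,i)\|_2\le f_1(n)\varepsilon\|\widetilde N_{[1]}(:,i)\|_2$ for every $i$, and $\|\Delta\widetilde N_{[2]}\|_2\le f_2(n)\varepsilon\|\widetilde N_{[2]}\|_2$. 5. $\widetilde{\mathbb A}-\lambda(\widetilde{\mathbb B}+\mathcal F)$ is an exactly reduced linearization of $\lambda^4A+\lambda^3B+\lambda^2(C+\Delta C)+\lambda(D+\Delta_\Sigma D)+(E+\Delta_\Sigma E)$. Namely,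 let $\widehat{\mathbb A}-\lambda\widehat{\mathbb B}$ be the linearization (as above) of this polynomial, let $\Pi$ be the permutation that lists the rows in the order $1{:}n+r,\ 2n+1{:}3n,\ n+r+1{:}2n,\ 3n+1{:}4n$, and put $P=(I_{2n+r}\oplus\widehat Q_{A_{22}}^*\oplus I_{n-r})\,\Pi\,(I_n\oplus\widehat Q_E^*\oplus I_n\oplus\widehat Q_E^*)$, $Q=I_{3n}\oplus\widehat Q_E$. Then, for some matrix $S$, $$P\,\widehat{\mathbb A}\,Q=\begin{pmatrix}\widetilde{\mathbb A}&S\\0&0\end{pmatrix},\qquad P\,\widehat{\mathbb B}\,Q=\begin{pmatrix}\widetilde{\mathbb B}+\mathcal F&0\\0&-I_{n-r}\end{pmatrix}.$$ -/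

import Mathlib

noncomputable section

namespace QuarticDeflation

open Matrix

variable {𝕜 : Type*} [RCLike 𝕜]

/-! ### Floating point arithmetic (standard model)

All computations are described relationally: a relation `Fl… input output` says that `output` is a
possible result of the computation when every elementary operation commits a relative error of at
most `ε`, the relative accuracy of one operation in `𝕜` (real or complex) or in `ℝ`. -/

/-- `y` is a rounded value of the exact result `x`: `y = x (1 + δ)` with `|δ| ≤ ε`. -/
def Rnd (ε : ℝ) (x y : 𝕜) : Prop :=
  ∃ δ : 𝕜, ‖δ‖ ≤ ε ∧ y = x * (1 + δ)

/-- `FlTree ε s c`: `c` is the computed sum of the nonempty multiset `s`, the additions being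
carried out in an arbitrary order (an arbitrary summation tree). -/
inductive FlTree (ε : ℝ) : Multiset 𝕜 → 𝕜 → Prop
  | single (a : 𝕜) : FlTree ε {a} a
  | add (s t : Multiset 𝕜) (a b c : 𝕜) :
      FlTree ε s a → FlTree ε t b → Rnd ε (a + b) c → FlTree ε (s + t) c

/-- Computed sum of a possibly empty multiset. -/
def FlSum (ε : ℝ) (s : Multiset 𝕜) (c : 𝕜) : Prop :=
  (s = 0 ∧ c = 0) ∨ FlTree ε s c

/-- `w` is a computed value of `∑ i ∈ S, x i * y i`. -/
def FlDot {ι : Type*} (ε : ℝ) (S : Finset ι) (x y : ι → 𝕜) (w : 𝕜) : Prop :=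
  ∃ p : ι → 𝕜, (∀ i ∈ S, Rnd ε (x i * y i) (p i)) ∧ FlSum ε (S.val.map p) w

/-- The real number `σ` is a computed value of `∑ i ∈ S, |x i|²`. -/
def FlNormSq {ι : Type*} (ε : ℝ) (S : Finset ι) (x : ι → 𝕜) (σ : ℝ) : Prop :=
  ∃ p : ι → ℝ, (∀ i ∈ S, Rnd ε (‖x i‖ ^ 2) (p i)) ∧ FlSum ε (S.val.map p) σ

/-- `Z` is a computed value of the matrix product `X * Y` (conventional multiplication). -/
def FlMatMul {ι κ μ : Type*} [Fintype κ] (ε : ℝ) (X : Matrix ι κ 𝕜) (Y : Matrix κ μ 𝕜)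
    (Z : Matrix ι μ 𝕜) : Prop :=
  ∀ i j, FlDot ε Finset.univ (fun k => X i k) (fun k => Y k j) (Z i j)

/-! ### Householder QR factorization in floating point arithmetic -/

/-- Computed Householder reflector `I - τ v v^*`, acting on the coordinates `≥ k`, that maps the
part `x(k:n)` of the column `x` to `α e_k`. With `s = x_k / |x_k|` (and `s = 1` if `x_k = 0`) the
formulas are `α = - s ‖x(k:n)‖₂`, `v = x(k:n) - α e_k`, `τ = 2 / ‖v‖₂²`. If `x` is already zero
below position `k`, the reflection may be skipped. -/
def FlReflector {n : ℕ} (ε : ℝ) (k : Fin n) (x v : Fin n → 𝕜) (τ : ℝ) (α : 𝕜) : Prop :=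
  ((∀ i, k < i → x i = 0) ∧ v = 0 ∧ τ = 0 ∧ α = x k) ∨
  ((∃ i, k ≤ i ∧ x i ≠ 0) ∧
    ∃ (σ ρ a ν : ℝ) (s : 𝕜),
      FlNormSq ε (Finset.Ici k) x σ ∧ Rnd ε (√σ) ρ ∧
      Rnd ε ‖x k‖ a ∧ (x k = 0 → s = 1) ∧ (x k ≠ 0 → Rnd ε (x k / (a : 𝕜)) s) ∧
      Rnd ε (-(s * (ρ : 𝕜))) α ∧
      (∀ i, i < k → v i = 0) ∧ Rnd ε (x k - α) (v k) ∧ (∀ i, k < i → v i = x i) ∧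
      FlNormSq ε (Finset.Ici k) v ν ∧ Rnd ε (2 / ν) τ)

/-- `y` is the computed value of `(I - τ v v^*) b = b - v (τ (v^* b))`, where `v` is supported on
the coordinates `≥ k`; the coordinates `< k` are not touched. -/
def FlApply {n : ℕ} (ε : ℝ) (k : Fin n) (v : Fin n → 𝕜) (τ : ℝ) (b y : Fin n → 𝕜) : Prop :=
  ∃ (w t : 𝕜) (p : Fin n → 𝕜),
    FlDot ε (Finset.Ici k) (fun i => star (v i)) b w ∧ Rnd ε ((τ : 𝕜) * w) t ∧
    (∀ i, k ≤ i → Rnd ε (v i * t) (p i) ∧ Rnd ε (b i - p i) (y i)) ∧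
    (∀ i, i < k → y i = b i)

/-- `m` steps of the Householder QR factorization of `M`: the computed reflectors are given by
`v k`, `τ k` for `k < m`, and `T` is the final reduced matrix (zero below the diagonal in its first
`m` columns). -/
def FlHouseholderQR {n : ℕ} (ε : ℝ) (m : ℕ) (M : Matrix (Fin n) (Fin n) 𝕜)
    (v : Fin n → Fin n → 𝕜) (τ : Fin n → ℝ) (T : Matrix (Fin n) (Fin n) 𝕜) : Prop :=
  ∃ W : ℕ → Matrix (Fin n) (Fin n) 𝕜, W 0 = M ∧ W m = T ∧
    ∀ k : Fin n, (k : ℕ) < m →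
      (∀ j, j < k → ∀ i, W (k + 1) i j = W k i j) ∧
      FlReflector ε k (fun i => W k i k) (v k) (τ k) (W (k + 1) k k) ∧
      (∀ i, i < k → W (k + 1) i k = W k i k) ∧
      (∀ i, k < i → W (k + 1) i k = 0) ∧
      (∀ j, k < j → FlApply ε k (v k) (τ k) (fun i => W k i j) (fun i => W (k + 1) i j))

/-- `Q` is the explicitly formed product `H_0 H_1 ⋯ H_{m-1}` of the computed reflectors. -/
def FlFormQ {n : ℕ} (ε : ℝ) (m : ℕ) (v : Fin n → Fin n → 𝕜) (τ : Fin n → ℝ)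
    (Q : Matrix (Fin n) (Fin n) 𝕜) : Prop :=
  ∃ P : ℕ → Matrix (Fin n) (Fin n) 𝕜, P m = 1 ∧ P 0 = Q ∧
    ∀ k : Fin n, (k : ℕ) < m → ∀ j,
      FlApply ε k (v k) (τ k) (fun i => P (k + 1) i j) (fun i => P k i j)

/-- `X` is the computed value of `(H_0 H_1 ⋯ H_{m-1})^* M`, the reflectors being applied one after
the other without forming their product. -/
def FlApplyAdjoint {n : ℕ} (ε : ℝ) (m : ℕ) (v : Fin n → Fin n → 𝕜) (τ : Fin n → ℝ)
    (M X : Matrix (Fin n) (Fin n) 𝕜) : Prop :=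
  ∃ Z : ℕ → Matrix (Fin n) (Fin n) 𝕜, Z 0 = M ∧ Z m = X ∧
    ∀ k : Fin n, (k : ℕ) < m → ∀ j,
      FlApply ε k (v k) (τ k) (fun i => Z k i j) (fun i => Z (k + 1) i j)

/-! ### Norms -/

/-- Euclidean norm of the `j`-th column. -/
def colNorm {ι κ : Type*} [Fintype ι] (M : Matrix ι κ 𝕜) (j : κ) : ℝ :=
  √(∑ i, ‖M i j‖ ^ 2)

/-- Frobenius norm. -/
def frobNorm {ι κ : Type*} [Fintype ι] [Fintype κ] (M : Matrix ι κ 𝕜) : ℝ :=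
  √(∑ i, ∑ j, ‖M i j‖ ^ 2)

open scoped Matrix.Norms.L2Operator in
/-- Spectral norm. -/
def specNorm {ι κ : Type*} [Fintype ι] [Fintype κ] [DecidableEq κ] (M : Matrix ι κ 𝕜) : ℝ :=
  ‖M‖

/-- A moderate (mildly growing) function of the dimension: nonnegative, polynomially bounded. -/
def MildlyGrowing (f : ℕ → ℝ) : Prop :=
  ∃ (c : ℝ) (d : ℕ), ∀ n : ℕ, 0 ≤ f n ∧ f n ≤ c * ((n : ℝ) + 1) ^ d

/-! ### Row partitions

An `n`-element index set is split as `r + (n - r)`, or in the other order as `(n - r) + r`. -/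

/-- `{1,…,n} = {1,…,r} ∪ {r+1,…,n}`. -/
def splitEquiv {n r : ℕ} (hr : r ≤ n) : Fin r ⊕ Fin (n - r) ≃ Fin n :=
  finSumFinEquiv.trans (finCongr (by omega))

/-- `{1,…,n} = {1,…,n-r} ∪ {n-r+1,…,n}`. -/
def stackEquiv {n r : ℕ} (hr : r ≤ n) : Fin (n - r) ⊕ Fin r ≃ Fin n :=
  finSumFinEquiv.trans (finCongr (by omega))

/-- The first `r` rows of `M`. -/
def topRows {n r : ℕ} {κ : Type*} (hr : r ≤ n) (M : Matrix (Fin n) κ 𝕜) : Matrix (Fin r) κ 𝕜 :=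
  M.submatrix (fun i => splitEquiv hr (Sum.inl i)) id

/-- The last `n - r` rows of `M`. -/
def botRows {n r : ℕ} {κ : Type*} (hr : r ≤ n) (M : Matrix (Fin n) κ 𝕜) :
    Matrix (Fin (n - r)) κ 𝕜 :=
  M.submatrix (fun i => splitEquiv hr (Sum.inr i)) id

/-- The stacked matrix with block rows `X` (`n - r` rows) and `R` (`r` rows). -/
def stack {n r : ℕ} {κ : Type*} (hr : r ≤ n) (X : Matrix (Fin (n - r)) κ 𝕜)
    (R : Matrix (Fin r) κ 𝕜) : Matrix (Fin n) κ 𝕜 :=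
  (Matrix.fromRows X R).submatrix (stackEquiv hr).symm id

/-- The first `n - r` columns of `M`. -/
def omega₁ {n r : ℕ} {ι : Type*} (hr : r ≤ n) (M : Matrix ι (Fin n) 𝕜) :
    Matrix ι (Fin (n - r)) 𝕜 :=
  M.submatrix id (fun j => stackEquiv hr (Sum.inl j))

/-- The last `r` columns of `M`. -/
def omega₂ {n r : ℕ} {ι : Type*} (hr : r ≤ n) (M : Matrix ι (Fin n) 𝕜) : Matrix ι (Fin r) 𝕜 :=
  M.submatrix id (fun j => stackEquiv hr (Sum.inr j))

/-- Keep the rows with index `< r`, replace the others by zero. -/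
def keepRows {n : ℕ} {κ : Type*} (r : ℕ) (M : Matrix (Fin n) κ 𝕜) : Matrix (Fin n) κ 𝕜 :=
  Matrix.of fun i j => if (i : ℕ) < r then M i j else 0

/-- Column permutation `M Π`: column `j` of the result is column `π j` of `M`. -/
def permCols {ι κ : Type*} (M : Matrix ι κ 𝕜) (π : Equiv.Perm κ) : Matrix ι κ 𝕜 :=
  M.submatrix id π

/-! ### The two computed deflation steps

Column interchanges are exact, so a Householder QR factorization with column pivoting is the
Householder QR factorization of the matrix `M Π` whose columns are already in pivot order. The
permutation is left arbitrary; this covers every pivoting strategy. -/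

/-- The first computed step: pivoted Householder QR factorization of `E` (`m` reflectors),
truncated at the numerical rank `r` with threshold `thr`, and the computed products
`X = computed(Q^* D)`, `Y = computed(Q^* C)`. Here `Q` is the computed numerically unitary factor
and `R` (`r × n`) the truncated triangular factor, so that `E Π ≈ Q (R ; 0)`. -/
def ComputedFirstStep {n r : ℕ} (ε thr : ℝ) (hr : r ≤ n) (C D E : Matrix (Fin n) (Fin n) 𝕜)
    (π : Equiv.Perm (Fin n)) (Q : Matrix (Fin n) (Fin n) 𝕜) (R : Matrix (Fin r) (Fin n) 𝕜)
    (X Y : Matrix (Fin n) (Fin n) 𝕜) : Prop :=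
  ∃ (m : ℕ) (v : Fin n → Fin n → 𝕜) (τ : Fin n → ℝ) (T : Matrix (Fin n) (Fin n) 𝕜),
    r ≤ m ∧ m ≤ n ∧
    FlHouseholderQR ε m (permCols E π) v τ T ∧ FlFormQ ε m v τ Q ∧
    -- numerical rank: the `r` retained pivots are nonzero, and every discarded column is below
    -- the threshold relative to every retained pivot (no pivot retained: nothing nonzero is lost)
    (∀ i : Fin n, (i : ℕ) < r → T i i ≠ 0) ∧
    (∀ i j : Fin n, (i : ℕ) < r → r ≤ (j : ℕ) → colNorm (T - keepRows r T) j ≤ thr * ‖T i i‖) ∧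
    (r = 0 → T = 0) ∧
    R = topRows hr T ∧
    (FlMatMul ε Qᴴ D X ∨ FlApplyAdjoint ε m v τ D X) ∧
    (FlMatMul ε Qᴴ C Y ∨ FlApplyAdjoint ε m v τ C Y)

/-- The matrix `(X₂ ; R Π^T)` whose rank decides about the second deflation step. -/
def secondMatrix {n r : ℕ} (hr : r ≤ n) (π : Equiv.Perm (Fin n))
    (R : Matrix (Fin r) (Fin n) 𝕜) (X : Matrix (Fin n) (Fin n) 𝕜) : Matrix (Fin n) (Fin n) 𝕜 :=
  stack hr (botRows hr X) (permCols R π.symm)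

/-- The second computed step: pivoted Householder QR factorization of `(X₂ ; R Π^T)`, with
numerical rank `r₂`, and the computed update `Q₂^* (-Y₂, -Q_{E,2}^*, 0, 0 ; 0, 0, 0, -I)`, written
`(-N₁, -N₂, N₃, N₄)`. The factor `R₂` is `n × n` with the rows below `r₂` equal to zero; what is
discarded there is, column by column, at most `thr₂` relative to the column. -/
def ComputedSecondStep {n r : ℕ} (ε thr₂ : ℝ) (hr : r ≤ n) (r₂ : ℕ) (π : Equiv.Perm (Fin n))
    (Q : Matrix (Fin n) (Fin n) 𝕜) (R : Matrix (Fin r) (Fin n) 𝕜)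
    (X Y : Matrix (Fin n) (Fin n) 𝕜)
    (π₂ : Equiv.Perm (Fin n)) (Q₂ R₂ : Matrix (Fin n) (Fin n) 𝕜)
    (N₁ N₂ N₃ : Matrix (Fin n) (Fin n) 𝕜) (N₄ : Matrix (Fin n) (Fin r) 𝕜) : Prop :=
  ∃ (m : ℕ) (v : Fin n → Fin n → 𝕜) (τ : Fin n → ℝ) (T : Matrix (Fin n) (Fin n) 𝕜),
    r₂ ≤ m ∧ m ≤ n ∧
    FlHouseholderQR ε m (permCols (secondMatrix hr π R X) π₂) v τ T ∧ FlFormQ ε m v τ Q₂ ∧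
    (∀ i : Fin n, (i : ℕ) < r₂ → T i i ≠ 0) ∧
    (∀ j, colNorm (T - keepRows r₂ T) j ≤ thr₂ * colNorm T j) ∧
    R₂ = keepRows r₂ T ∧
    FlMatMul ε (omega₁ hr Q₂ᴴ) (botRows hr Y) N₁ ∧
    FlMatMul ε (omega₁ hr Q₂ᴴ) (botRows hr Qᴴ) N₂ ∧
    N₃ = 0 ∧
    N₄ = -omega₂ hr Q₂ᴴ

/-! ### Pencils -/

/-- Index set of the `4n × 4n` linearization. -/
abbrev LinIdx (n : ℕ) : Type := (Fin n ⊕ Fin n) ⊕ (Fin n ⊕ Fin n)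

/-- Row index set of the reduced pencil: blocks of sizes `n, r, n, n`. -/
abbrev RowIdx (n r : ℕ) : Type := (Fin n ⊕ (Fin r ⊕ Fin n)) ⊕ Fin n

/-- Column index set of the reduced pencil: blocks of sizes `n, n, n, r`. -/
abbrev ColIdx (n r : ℕ) : Type := (Fin n ⊕ Fin n) ⊕ (Fin n ⊕ Fin r)

/-- The matrix `𝔸` of the linearization `𝔸 - λ 𝔹` of `λ⁴A + λ³B + λ²C + λD + E`. -/
def linA {n : ℕ} (B D E : Matrix (Fin n) (Fin n) 𝕜) : Matrix (LinIdx n) (LinIdx n) 𝕜 :=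
  fromBlocks (fromBlocks B 0 D 0) (-1) (fromBlocks 0 (-1) E 0) 0

/-- The matrix `𝔹` of the linearization `𝔸 - λ 𝔹` of `λ⁴A + λ³B + λ²C + λD + E`. -/
def linB {n : ℕ} (A C : Matrix (Fin n) (Fin n) 𝕜) : Matrix (LinIdx n) (LinIdx n) 𝕜 :=
  fromBlocks (fromBlocks (-A) 0 (-C) (-1)) 0 0 (-1)

/-- The computed matrix `P₂ 𝔸₂₂`; `S` is the `n × n` block `(R₂ Π₂^T ; 0)`. -/
def redA {n r : ℕ} (B : Matrix (Fin n) (Fin n) 𝕜) (X₁ : Matrix (Fin r) (Fin n) 𝕜)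
    (S : Matrix (Fin n) (Fin n) 𝕜) : Matrix (RowIdx n r) (ColIdx n r) 𝕜 :=
  fromBlocks
    (fromBlocks B 0 (fromRows X₁ 0) (fromRows 0 (-1)))
    (fromBlocks (-1) 0 0 (fromRows (-1) 0))
    (fromCols S 0) 0

/-- The computed matrix `P₂ 𝔹₂₂`; `U` is the stored block `Q_{E,1}^*`. -/
def redB {n r : ℕ} (A : Matrix (Fin n) (Fin n) 𝕜) (Y₁ U : Matrix (Fin r) (Fin n) 𝕜)
    (N₁ N₂ N₃ : Matrix (Fin n) (Fin n) 𝕜) (N₄ : Matrix (Fin n) (Fin r) 𝕜) :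
    Matrix (RowIdx n r) (ColIdx n r) 𝕜 :=
  fromBlocks
    (fromBlocks (-A) 0 (fromRows (-Y₁) 0) (fromRows (-U) 0))
    (fromBlocks 0 0 (fromRows 0 (-1)) 0)
    (fromCols (-N₁) (-N₂)) (fromCols N₃ N₄)

/-- The structured forward perturbation of `P₂ 𝔹₂₂`. -/
def forwardPert {n r : ℕ} (dU : Matrix (Fin r) (Fin n) 𝕜) (dN₁ dN₂ : Matrix (Fin n) (Fin n) 𝕜)
    (dN₄ : Matrix (Fin n) (Fin r) 𝕜) : Matrix (RowIdx n r) (ColIdx n r) 𝕜 :=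
  fromBlocks
    (fromBlocks 0 0 0 (fromRows (-dU) 0)) 0
    (fromCols dN₁ dN₂) (fromCols 0 dN₄)

/-- The row permutation: it lists the rows of the linearization in the order `1:n+r`, `2n+1:3n`,
`n+r+1:2n`, `3n+1:3n+r`, followed by the last `n - r` rows. -/
def rowPerm {n r : ℕ} (hr : r ≤ n) : RowIdx n r ⊕ Fin (n - r) → LinIdx n
  | Sum.inl (Sum.inl (Sum.inl i)) => Sum.inl (Sum.inl i)
  | Sum.inl (Sum.inl (Sum.inr (Sum.inl i))) => Sum.inl (Sum.inr (splitEquiv hr (Sum.inl i)))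
  | Sum.inl (Sum.inl (Sum.inr (Sum.inr i))) => Sum.inr (Sum.inl i)
  | Sum.inl (Sum.inr i) =>
      Sum.elim (fun a => Sum.inl (Sum.inr (splitEquiv hr (Sum.inr a))))
        (fun b => Sum.inr (Sum.inr (splitEquiv hr (Sum.inl b)))) ((stackEquiv hr).symm i)
  | Sum.inr i => Sum.inr (Sum.inr (splitEquiv hr (Sum.inr i)))

/-- The columns of the linearization in their original order, partitioned as `(3n+r) + (n-r)`. -/
def colPart {n r : ℕ} (hr : r ≤ n) : ColIdx n r ⊕ Fin (n - r) → LinIdx n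
  | Sum.inl (Sum.inl i) => Sum.inl i
  | Sum.inl (Sum.inr (Sum.inl i)) => Sum.inr (Sum.inl i)
  | Sum.inl (Sum.inr (Sum.inr i)) => Sum.inr (Sum.inr (splitEquiv hr (Sum.inl i)))
  | Sum.inr i => Sum.inr (Sum.inr (splitEquiv hr (Sum.inr i)))

theorem rowPerm_bijective {n r : ℕ} (hr : r ≤ n) : Function.Bijective (rowPerm hr) := by
  rw [Fintype.bijective_iff_surjective_and_card]
  constructor
  · rintro ((i | i) | (i | i))
    · exact ⟨Sum.inl (Sum.inl (Sum.inl i)), rfl⟩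
    · obtain ⟨x, rfl⟩ := (splitEquiv hr).surjective i
      rcases x with a | b
      · exact ⟨Sum.inl (Sum.inl (Sum.inr (Sum.inl a))), rfl⟩
      · exact ⟨Sum.inl (Sum.inr (stackEquiv hr (Sum.inl b))), by simp [rowPerm]⟩
    · exact ⟨Sum.inl (Sum.inl (Sum.inr (Sum.inr i))), rfl⟩
    · obtain ⟨x, rfl⟩ := (splitEquiv hr).surjective i
      rcases x with a | b
      · exact ⟨Sum.inl (Sum.inr (stackEquiv hr (Sum.inr a))), by simp [rowPerm]⟩
      · exact ⟨Sum.inr b, rfl⟩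
  · simp only [Fintype.card_sum, Fintype.card_fin]
    omega

theorem colPart_bijective {n r : ℕ} (hr : r ≤ n) : Function.Bijective (colPart hr) := by
  rw [Fintype.bijective_iff_surjective_and_card]
  constructor
  · rintro (i | (i | i))
    · exact ⟨Sum.inl (Sum.inl i), rfl⟩
    · exact ⟨Sum.inl (Sum.inr (Sum.inl i)), rfl⟩
    · obtain ⟨x, rfl⟩ := (splitEquiv hr).surjective i
      rcases x with a | b
      · exact ⟨Sum.inl (Sum.inr (Sum.inr a)), rfl⟩
      · exact ⟨Sum.inr b, rfl⟩
  · simp only [Fintype.card_sum, Fintype.card_fin]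
    omega

/-- The equivalence transformation of the two deflation steps with the (exactly unitary) matrices
`QE`, `Q₂`, applied to a `4n × 4n` matrix `M`:
`(I ⊕ Q₂^* ⊕ I) · permutation · (I ⊕ QE^* ⊕ I ⊕ QE^*) · M · (I ⊕ I ⊕ I ⊕ QE)`. -/
def deflationTransform {n r : ℕ} (hr : r ≤ n) (QE Q₂ : Matrix (Fin n) (Fin n) 𝕜)
    (M : Matrix (LinIdx n) (LinIdx n) 𝕜) :
    Matrix (RowIdx n r ⊕ Fin (n - r)) (ColIdx n r ⊕ Fin (n - r)) 𝕜 :=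
  (fromBlocks (fromBlocks 1 0 0 Q₂ᴴ) 0 0 1 :
      Matrix (RowIdx n r ⊕ Fin (n - r)) (RowIdx n r ⊕ Fin (n - r)) 𝕜) *
    ((fromBlocks (fromBlocks 1 0 0 QEᴴ) 0 0 (fromBlocks 1 0 0 QEᴴ) :
        Matrix (LinIdx n) (LinIdx n) 𝕜) * M *
      (fromBlocks 1 0 0 (fromBlocks 1 0 0 QE) : Matrix (LinIdx n) (LinIdx n) 𝕜)).submatrix
        (rowPerm hr) (colPart hr)

end QuarticDeflation

end

/-!
Rounding errors are counted in powers of `1 + ε`. The computed Householder vector may be far from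
the exact one only if a pivot suffers cancellation, which the choice of its sign rules out; hence
each computed reflection is close to an exact one, relative to the norm of every column it is
applied to. Since exact reflections preserve norms, these errors only add up, column by column.

In the second factorization the backward error `(Γ₁; Γ₂)` has to be pulled back to the coefficients
`D` and `E`. As the columns of the unitary factor `U` of the first step are orthonormal, adding
`U_2 Γ₁` to `D` changes only the last `n - r` rows of `U^* D` (by `Γ₁`), and adding `U_1 Γ₂` to `E`
changes only the first `r` rows of `U^* E` (by `Γ₂`). The errors of the remaining products cannot
be absorbed in this way and become forward errors of the pencil. They are small relative to the
stored blocks because these are, up to rounding, products of a given matrix with an isometry, whose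
norm is that of the given matrix.
-/

noncomputable section

namespace QuarticDeflation

open Matrix WithLp

section RunningError

/-- The accumulated relative error `(1 + ε) ^ k - 1` of `k` successive roundings; it plays the role
of `γ_k = kε / (1 - kε)` in rounding error analysis. -/
def relErr (ε : ℝ) (k : ℕ) : ℝ := (1 + ε) ^ k - 1

variable {ε : ℝ} {j k : ℕ}

theorem one_add_relErr (ε : ℝ) (k : ℕ) : 1 + relErr ε k = (1 + ε) ^ k := by
  rw [relErr, add_sub_cancel]

theorem one_add_relErr_mul (ε : ℝ) (j k : ℕ) :
    (1 + relErr ε j) * (1 + relErr ε k) = 1 + relErr ε (j + k) := by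
  simp only [one_add_relErr, pow_add]

theorem relErr_nonneg (hε : 0 ≤ ε) (k : ℕ) : 0 ≤ relErr ε k :=
  sub_nonneg.2 (one_le_pow₀ (by linarith))

theorem relErr_mono (hε : 0 ≤ ε) (h : j ≤ k) : relErr ε j ≤ relErr ε k :=
  sub_le_sub_right (pow_le_pow_right₀ (by linarith) h) 1

theorem natCast_mul_relErr_le (hε : 0 ≤ ε) (m k : ℕ) : m * relErr ε k ≤ relErr ε (m * k) := by
  have bernoulli := one_add_mul_le_pow (by linarith [relErr_nonneg hε k] : -2 ≤ relErr ε k) m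
  rw [one_add_relErr, ← pow_mul, mul_comm k, ← one_add_relErr] at bernoulli
  linarith

theorem mul_relErr_le (hε : 0 ≤ ε) {c : ℝ} {m l : ℕ} (hc : c ≤ m) (hl : m * k ≤ l) :
    c * relErr ε k ≤ relErr ε l :=
  calc c * relErr ε k ≤ m * relErr ε k := mul_le_mul_of_nonneg_right hc (relErr_nonneg hε k)
    _ ≤ relErr ε (m * k) := natCast_mul_relErr_le hε m k
    _ ≤ relErr ε l := relErr_mono hε hl

theorem relErr_le_two_mul (hε : 0 ≤ ε) : ∀ k : ℕ, k * ε ≤ 1 / 2 → relErr ε k ≤ 2 * (k * ε)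
  | 0, _ => by simp [relErr]
  | k + 1, hk => by
    push_cast at hk ⊢
    have ih := relErr_le_two_mul hε k (by linarith)
    have step := one_add_relErr_mul ε k 1
    rw [one_add_relErr ε 1, pow_one] at step
    nlinarith

theorem norm_sub_le_relErr_of_forall_step {V : Type*} [SeminormedAddCommGroup V] (hε : 0 ≤ ε)
    {a : ℕ → V} {m : ℕ} (step : ∀ i < m, ‖a (i + 1) - a i‖ ≤ relErr ε k * ‖a i‖) :
    ‖a m - a 0‖ ≤ relErr ε (m * k) * ‖a 0‖ := by
  induction m with
  | zero => simp [relErr]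
  | succ m ih =>
    have ih := ih fun i hi => step i (by omega)
    have last := step m (by omega)
    have norm_am : ‖a m‖ ≤ (1 + relErr ε (m * k)) * ‖a 0‖ := by
      linarith [norm_le_norm_add_norm_sub' (a m) (a 0)]
    calc ‖a (m + 1) - a 0‖ ≤ ‖a (m + 1) - a m‖ + ‖a m - a 0‖ := norm_sub_le_norm_sub_add_norm_sub ..
      _ ≤ relErr ε k * ((1 + relErr ε (m * k)) * ‖a 0‖) + relErr ε (m * k) * ‖a 0‖ :=
        add_le_add (last.trans (mul_le_mul_of_nonneg_left norm_am (relErr_nonneg hε k))) ih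
      _ = ((1 + relErr ε (m * k)) * (1 + relErr ε k) - 1) * ‖a 0‖ := by ring
      _ = relErr ε ((m + 1) * k) * ‖a 0‖ := by
        rw [one_add_relErr_mul, add_sub_cancel_left, Nat.succ_mul]

/-- `IsApprox ε k s x y`: after `k` roundings `y` approximates `x` up to the relative error
`relErr ε k` of the magnitude `s`, an upper bound of `‖x‖` that survives cancellation. -/
def IsApprox {V : Type*} [SeminormedAddCommGroup V] (ε : ℝ) (k : ℕ) (s : ℝ) (x y : V) : Prop :=
  ‖x‖ ≤ s ∧ ‖y - x‖ ≤ relErr ε k * s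

namespace IsApprox

section Group

variable {V : Type*} [SeminormedAddCommGroup V] {x y z x' y' : V} {s s' : ℝ}

theorem refl (ε : ℝ) (x : V) : IsApprox ε 0 ‖x‖ x x := by simp [IsApprox, relErr]

theorem nonneg (h : IsApprox ε k s x y) : 0 ≤ s := (norm_nonneg x).trans h.1

theorem norm_le (h : IsApprox ε k s x y) : ‖y‖ ≤ (1 + relErr ε k) * s := by
  linarith [h.1, h.2, norm_le_norm_add_norm_sub' y x]

theorem mono (hε : 0 ≤ ε) (h : IsApprox ε j s x y) (hk : j ≤ k) (hs : s ≤ s') :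
    IsApprox ε k s' x y :=
  ⟨h.1.trans hs, h.2.trans (mul_le_mul (relErr_mono hε hk) hs h.nonneg (relErr_nonneg hε k))⟩

theorem trans (h : IsApprox ε j s x y) (h' : IsApprox ε k ((1 + relErr ε j) * s) y z) :
    IsApprox ε (j + k) s x z := by
  refine ⟨h.1, ?_⟩
  calc ‖z - x‖ ≤ ‖z - y‖ + ‖y - x‖ := norm_sub_le_norm_sub_add_norm_sub ..
    _ ≤ relErr ε k * ((1 + relErr ε j) * s) + relErr ε j * s := add_le_add h'.2 h.2
    _ = ((1 + relErr ε j) * (1 + relErr ε k) - 1) * s := by ring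
    _ = relErr ε (j + k) * s := by rw [one_add_relErr_mul, add_sub_cancel_left]

theorem neg (h : IsApprox ε k s x y) : IsApprox ε k s (-x) (-y) := by
  rwa [IsApprox, norm_neg, neg_sub_neg, norm_sub_rev]

theorem add (h : IsApprox ε k s x y) (h' : IsApprox ε k s' x' y') :
    IsApprox ε k (s + s') (x + x') (y + y') := by
  refine ⟨norm_add_le_of_le h.1 h'.1, ?_⟩
  rw [add_sub_add_comm, mul_add]
  exact norm_add_le_of_le h.2 h'.2

theorem sub (h : IsApprox ε k s x y) (h' : IsApprox ε k s' x' y') :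
    IsApprox ε k (s + s') (x - x') (y - y') := by
  simpa only [sub_eq_add_neg] using h.add h'.neg

theorem sum {ι : Type*} {S : Finset ι} {s : ι → ℝ} {x y : ι → V}
    (h : ∀ i ∈ S, IsApprox ε k (s i) (x i) (y i)) :
    IsApprox ε k (∑ i ∈ S, s i) (∑ i ∈ S, x i) (∑ i ∈ S, y i) := by
  refine ⟨norm_sum_le_of_le S fun i hi => (h i hi).1, ?_⟩
  rw [← Finset.sum_sub_distrib, Finset.mul_sum]
  exact norm_sum_le_of_le S fun i hi => (h i hi).2

end Group

theorem mul {R : Type*} [NonUnitalSeminormedRing R] {x y x' y' : R} {s s' : ℝ}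
    (h : IsApprox ε j s x y) (h' : IsApprox ε k s' x' y') :
    IsApprox ε (j + k) (s * s') (x * x') (y * y') := by
  refine ⟨(norm_mul_le x x').trans (mul_le_mul h.1 h'.1 (norm_nonneg _) h.nonneg), ?_⟩
  have split : y * y' - x * x' = (y - x) * y' + x * (y' - x') := by noncomm_ring
  calc ‖y * y' - x * x'‖ ≤ ‖y - x‖ * ‖y'‖ + ‖x‖ * ‖y' - x'‖ := by
        rw [split]
        exact norm_add_le_of_le (norm_mul_le _ _) (norm_mul_le _ _)
    _ ≤ relErr ε j * s * ((1 + relErr ε k) * s') + s * (relErr ε k * s') :=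
        add_le_add
          (mul_le_mul h.2 h'.norm_le (norm_nonneg _) ((norm_nonneg _).trans h.2))
          (mul_le_mul h.1 h'.2 (norm_nonneg _) h.nonneg)
    _ = ((1 + relErr ε j) * (1 + relErr ε k) - 1) * (s * s') := by ring
    _ = relErr ε (j + k) * (s * s') := by rw [one_add_relErr_mul, add_sub_cancel_left]

theorem inv {K : Type*} [NormedField K] {a b : K} (hε : 0 ≤ ε) (hk : relErr ε k ≤ 1 / 2)
    (h : IsApprox ε k ‖a‖ a b) : IsApprox ε (2 * k) ‖a⁻¹‖ a⁻¹ b⁻¹ := by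
  refine ⟨le_rfl, ?_⟩
  have nearby := h.2
  rcases eq_or_ne a 0 with rfl | ha
  · obtain rfl : b = 0 := by simpa using nearby
    simp
  have a_pos : 0 < ‖a‖ := norm_pos_iff.2 ha
  have b_large : ‖a‖ ≤ 2 * ‖b‖ := by
    have := norm_sub_norm_le a b
    rw [norm_sub_rev] at this
    nlinarith
  have hb : b ≠ 0 := norm_pos_iff.1 (by linarith)
  have difference : b⁻¹ - a⁻¹ = (a - b) * (a⁻¹ * b⁻¹) := by field_simp
  calc ‖b⁻¹ - a⁻¹‖ = ‖b - a‖ * (‖a‖⁻¹ * ‖b‖⁻¹) := by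
        rw [difference, norm_mul, norm_mul, norm_inv, norm_inv, norm_sub_rev]
    _ ≤ relErr ε k * (2 * ‖b‖) * (‖a‖⁻¹ * ‖b‖⁻¹) := by
        gcongr
        exact nearby.trans (mul_le_mul_of_nonneg_left b_large (relErr_nonneg hε k))
    _ = 2 * relErr ε k * ‖a⁻¹‖ := by
        have : ‖b‖ ≠ 0 := norm_ne_zero_iff.2 hb
        rw [norm_inv]
        field_simp
    _ ≤ relErr ε (2 * k) * ‖a⁻¹‖ := by
        gcongr
        exact mul_relErr_le hε (m := 2) (by norm_num) le_rfl

theorem sqrt {a b : ℝ} (hk : relErr ε k ≤ 1) (ha : 0 ≤ a) (h : IsApprox ε k a a b) :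
    IsApprox ε k (√a) (√a) (√b) := by
  refine ⟨(Real.norm_of_nonneg (Real.sqrt_nonneg a)).le, ?_⟩
  have nearby : |b - a| ≤ relErr ε k * a := h.2
  have hb : 0 ≤ b := by nlinarith [neg_abs_le (b - a)]
  rcases ha.eq_or_lt with rfl | a_pos
  · obtain rfl : b = 0 := by simpa using nearby
    simp
  have sqrt_pos := Real.sqrt_pos.2 a_pos
  have product : |√b - √a| * (√b + √a) ≤ relErr ε k * √a * √a := by
    rw [mul_assoc, Real.mul_self_sqrt ha]
    refine le_trans (le_of_eq ?_) nearby
    rw [← abs_of_nonneg (add_nonneg (Real.sqrt_nonneg b) sqrt_pos.le), ← abs_mul]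
    congr 1
    linear_combination Real.mul_self_sqrt hb - Real.mul_self_sqrt ha
  refine le_of_mul_le_mul_right (le_trans ?_ product) sqrt_pos
  exact mul_le_mul_of_nonneg_left (by linarith [Real.sqrt_nonneg b]) (abs_nonneg _)

end IsApprox

end RunningError

section Arithmetic

variable {𝕜 : Type*} [RCLike 𝕜] {ε : ℝ} {k : ℕ}

theorem Rnd.isApprox {x y : 𝕜} {s : ℝ} (h : Rnd ε x y) (hx : ‖x‖ ≤ s) : IsApprox ε 1 s x y := by
  obtain ⟨δ, hδ, rfl⟩ := h
  refine ⟨hx, ?_⟩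
  calc ‖x * (1 + δ) - x‖ = ‖δ‖ * ‖x‖ := by rw [← norm_mul]; congr 1; ring
    _ ≤ ε * s := mul_le_mul hδ hx (norm_nonneg x) ((norm_nonneg δ).trans hδ)
    _ = relErr ε 1 * s := by rw [relErr, pow_one, add_sub_cancel_left]

theorem IsApprox.rnd {x y z : 𝕜} {s : ℝ} (h : IsApprox ε k s x y) (hz : Rnd ε y z) :
    IsApprox ε (k + 1) s x z :=
  h.trans (hz.isApprox h.norm_le)

theorem IsApprox.ofReal {a b s : ℝ} (h : IsApprox ε k s a b) :
    IsApprox ε k s (a : 𝕜) (b : 𝕜) := by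
  rwa [IsApprox, ← RCLike.ofReal_sub, RCLike.norm_ofReal, RCLike.norm_ofReal]

theorem FlTree.card_pos {s : Multiset 𝕜} {c : 𝕜} (h : FlTree ε s c) : 0 < s.card := by
  induction h with
  | single a => simp
  | add s t a b c _ _ _ ihs _ => rw [Multiset.card_add]; omega

theorem FlTree.isApprox (hε : 0 ≤ ε) {s : Multiset 𝕜} {c : 𝕜} (h : FlTree ε s c) :
    IsApprox ε s.card (s.map norm).sum s.sum c := by
  induction h with
  | single a => simpa using (IsApprox.refl ε a).mono hε zero_le_one le_rfl
  | add s t a b c hs ht hc ihs iht =>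
    have := hs.card_pos
    have := ht.card_pos
    rw [Multiset.map_add, Multiset.sum_add, Multiset.sum_add, Multiset.card_add]
    exact (((ihs.mono hε (le_max_left _ _) le_rfl).add (iht.mono hε (le_max_right _ _) le_rfl)).rnd
      hc).mono hε (by omega) le_rfl

theorem FlSum.isApprox (hε : 0 ≤ ε) {s : Multiset 𝕜} {c : 𝕜} (h : FlSum ε s c) :
    IsApprox ε s.card (s.map norm).sum s.sum c := by
  rcases h with ⟨rfl, rfl⟩ | h
  · simpa using IsApprox.refl ε (0 : 𝕜)
  · exact h.isApprox hε

theorem FlSum.isApprox_sum {ι : Type*} (hε : 0 ≤ ε) {S : Finset ι} {s : ι → ℝ} {x p : ι → 𝕜}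
    {w : 𝕜} (hw : FlSum ε (S.val.map p) w) (hp : ∀ i ∈ S, IsApprox ε k (s i) (x i) (p i)) :
    IsApprox ε (k + S.card) (∑ i ∈ S, s i) (∑ i ∈ S, x i) w := by
  have summed := hw.isApprox hε
  rw [Multiset.map_map, Multiset.card_map] at summed
  refine (IsApprox.sum hp).trans (summed.mono hε le_rfl ?_)
  rw [Finset.mul_sum]
  exact Finset.sum_le_sum fun i hi => (hp i hi).norm_le

theorem FlDot.isApprox {ι : Type*} (hε : 0 ≤ ε) {S : Finset ι} {x y : ι → 𝕜} {w : 𝕜}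
    (h : FlDot ε S x y w) :
    IsApprox ε (1 + S.card) (∑ i ∈ S, ‖x i‖ * ‖y i‖) (∑ i ∈ S, x i * y i) w := by
  obtain ⟨p, hp, hw⟩ := h
  exact hw.isApprox_sum hε fun i hi => (hp i hi).isApprox (norm_mul_le _ _)

theorem FlNormSq.isApprox {ι : Type*} (hε : 0 ≤ ε) {S : Finset ι} {x : ι → 𝕜} {σ : ℝ}
    (h : FlNormSq ε S x σ) :
    IsApprox ε (1 + S.card) (∑ i ∈ S, ‖x i‖ ^ 2) (∑ i ∈ S, ‖x i‖ ^ 2) σ := by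
  obtain ⟨p, hp, hw⟩ := h
  exact hw.isApprox_sum hε fun i hi => (hp i hi).isApprox (Real.norm_of_nonneg (sq_nonneg _)).le

end Arithmetic

/-- The Euclidean norm of a plain vector. -/
local notation "‖" x "‖₂" => norm (toLp 2 x)

section Vectors

variable {𝕜 : Type*} [RCLike 𝕜] {ι : Type*} [Fintype ι]

theorem norm_apply_le_norm_toLp (x : ι → 𝕜) (i : ι) : ‖x i‖ ≤ ‖x‖₂ :=
  PiLp.norm_apply_le (toLp 2 x) i

theorem norm_toLp_le_of_forall_le {κ : Type*} [RCLike κ] {x : ι → 𝕜} {s : ι → κ}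
    (h : ∀ i, ‖x i‖ ≤ ‖s i‖) : ‖x‖₂ ≤ ‖s‖₂ := by
  simp only [EuclideanSpace.norm_eq]
  gcongr with i
  exact h i

theorem norm_toLp_sub_le_of_isApprox {ε : ℝ} {k : ℕ} (hε : 0 ≤ ε) {s : ι → ℝ} {x y : ι → 𝕜}
    (h : ∀ i, IsApprox ε k (s i) (x i) (y i)) : ‖y - x‖₂ ≤ relErr ε k * ‖s‖₂ := by
  have entrywise : ‖y - x‖₂ ≤ ‖relErr ε k • s‖₂ := norm_toLp_le_of_forall_le fun i =>
    (h i).2.trans (le_abs_self _)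
  rwa [toLp_smul, norm_smul, Real.norm_of_nonneg (relErr_nonneg hε k)] at entrywise

theorem sum_norm_mul_norm_le (S : Finset ι) (x y : ι → 𝕜) :
    ∑ i ∈ S, ‖x i‖ * ‖y i‖ ≤ ‖x‖₂ * ‖y‖₂ := by
  simp only [EuclideanSpace.norm_eq]
  calc ∑ i ∈ S, ‖x i‖ * ‖y i‖ ≤ ∑ i, ‖x i‖ * ‖y i‖ :=
        Finset.sum_le_univ_sum_of_nonneg fun i => by positivity
    _ ≤ _ := Real.sum_mul_le_sqrt_mul_sqrt _ _ _

end Vectors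

section Matrices

variable {𝕜 : Type*} [RCLike 𝕜] {ι κ μ : Type*} [Fintype ι]

theorem colNorm_eq_norm (M : Matrix ι κ 𝕜) (j : κ) : colNorm M j = ‖M.col j‖₂ :=
  (EuclideanSpace.norm_eq (toLp 2 (M.col j))).symm

theorem colNorm_nonneg (M : Matrix ι κ 𝕜) (j : κ) : 0 ≤ colNorm M j := Real.sqrt_nonneg _

theorem norm_apply_le_colNorm (M : Matrix ι κ 𝕜) (i : ι) (j : κ) : ‖M i j‖ ≤ colNorm M j := by
  rw [colNorm_eq_norm]
  exact norm_apply_le_norm_toLp (M.col j) i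

theorem colNorm_sub_rev (M N : Matrix ι κ 𝕜) (j : κ) : colNorm (M - N) j = colNorm (N - M) j := by
  simp only [colNorm_eq_norm]
  exact norm_sub_rev (toLp 2 (M.col j)) (toLp 2 (N.col j))

theorem colNorm_sub_le_add (M N P : Matrix ι κ 𝕜) (j : κ) :
    colNorm (M - P) j ≤ colNorm (M - N) j + colNorm (N - P) j := by
  simp only [colNorm_eq_norm]
  exact norm_sub_le_norm_sub_add_norm_sub (toLp 2 (M.col j)) (toLp 2 (N.col j)) (toLp 2 (P.col j))

theorem colNorm_le_add_sub (M N : Matrix ι κ 𝕜) (j : κ) :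
    colNorm M j ≤ colNorm N j + colNorm (M - N) j := by
  simp only [colNorm_eq_norm]
  exact norm_le_norm_add_norm_sub' (toLp 2 (M.col j)) (toLp 2 (N.col j))

theorem colNorm_submatrix_le [Fintype μ] (M : Matrix ι κ 𝕜) {e : μ → ι} (he : e.Injective) (j : κ) :
    colNorm (M.submatrix e id) j ≤ colNorm M j := by
  refine Real.sqrt_le_sqrt ?_
  refine le_of_eq_of_le (Finset.sum_map Finset.univ ⟨e, he⟩ fun i => ‖M i j‖ ^ 2).symm ?_
  exact Finset.sum_le_univ_sum_of_nonneg fun i => sq_nonneg _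

theorem norm_mulVec_of_isometry [Fintype κ] [DecidableEq κ] {U : Matrix ι κ 𝕜} (hU : Uᴴ * U = 1)
    (x : κ → 𝕜) : ‖U *ᵥ x‖₂ = ‖x‖₂ := by
  rw [@norm_eq_sqrt_re_inner 𝕜, @norm_eq_sqrt_re_inner 𝕜, EuclideanSpace.inner_toLp_toLp,
    EuclideanSpace.inner_toLp_toLp, star_mulVec, dotProduct_comm, ← dotProduct_mulVec,
    mulVec_mulVec, hU, one_mulVec, dotProduct_comm]

theorem colNorm_mul_of_isometry [Fintype κ] [DecidableEq κ] {U : Matrix ι κ 𝕜} (hU : Uᴴ * U = 1)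
    (M : Matrix κ μ 𝕜) (j : μ) : colNorm (U * M) j = colNorm M j := by
  rw [colNorm_eq_norm, colNorm_eq_norm, ← norm_mulVec_of_isometry hU]
  rfl

variable [Fintype κ]

theorem frobNorm_nonneg (M : Matrix ι κ 𝕜) : 0 ≤ frobNorm M := Real.sqrt_nonneg _

section Frobenius

open scoped Matrix.Norms.Frobenius

theorem frobNorm_eq_norm (M : Matrix ι κ 𝕜) : frobNorm M = ‖M‖ := by
  rw [frobenius_norm_def, ← Real.sqrt_eq_rpow]
  simp only [Real.rpow_ofNat, frobNorm]

theorem frobNorm_conjTranspose (M : Matrix ι κ 𝕜) : frobNorm Mᴴ = frobNorm M := by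
  rw [frobNorm_eq_norm, frobNorm_eq_norm, frobenius_norm_conjTranspose]

theorem frobNorm_sub_rev (M N : Matrix ι κ 𝕜) : frobNorm (M - N) = frobNorm (N - M) := by
  simpa only [frobNorm_eq_norm] using norm_sub_rev M N

theorem frobNorm_conjTranspose_sub (M N : Matrix ι κ 𝕜) :
    frobNorm (Mᴴ - Nᴴ) = frobNorm (M - N) := by
  rw [← conjTranspose_sub, frobNorm_conjTranspose]

theorem frobNorm_le_add_sub (M N : Matrix ι κ 𝕜) : frobNorm M ≤ frobNorm N + frobNorm (M - N) := by
  simpa only [frobNorm_eq_norm] using norm_le_norm_add_norm_sub' M N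

theorem frobNorm_sub_le_add (M N P : Matrix ι κ 𝕜) :
    frobNorm (M - P) ≤ frobNorm (M - N) + frobNorm (N - P) := by
  simpa only [frobNorm_eq_norm] using norm_sub_le_norm_sub_add_norm_sub M N P

theorem frobNorm_one (ι : Type*) [Fintype ι] [DecidableEq ι] :
    frobNorm (1 : Matrix ι ι 𝕜) = √(Fintype.card ι) := by
  rw [frobNorm_eq_norm, ← coe_nnnorm, frobenius_nnnorm_one]
  simp

theorem norm_mulVec_le (M : Matrix ι κ 𝕜) (x : κ → 𝕜) : ‖M *ᵥ x‖₂ ≤ frobNorm M * ‖x‖₂ := by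
  rw [frobNorm_eq_norm, ← frobenius_norm_replicateCol (ι := Unit),
    ← frobenius_norm_replicateCol (ι := Unit), replicateCol_mulVec]
  exact frobenius_norm_mul M _

end Frobenius

theorem colNorm_mul_le (M : Matrix ι κ 𝕜) (N : Matrix κ μ 𝕜) (j : μ) :
    colNorm (M * N) j ≤ frobNorm M * colNorm N j := by
  rw [colNorm_eq_norm, colNorm_eq_norm]
  exact norm_mulVec_le M (N.col j)

theorem frobNorm_eq_sqrt_sum_colNorm (M : Matrix ι κ 𝕜) : frobNorm M = √(∑ j, colNorm M j ^ 2) := by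
  simp only [colNorm, Real.sq_sqrt (Finset.sum_nonneg fun i _ => sq_nonneg ‖M i _‖)]
  rw [Finset.sum_comm, frobNorm]

theorem frobNorm_le_of_colNorm_le {ι' : Type*} [Fintype ι'] {M : Matrix ι κ 𝕜} {N : Matrix ι' κ 𝕜}
    {c : ℝ} (hc : 0 ≤ c) (h : ∀ j, colNorm M j ≤ c * colNorm N j) :
    frobNorm M ≤ c * frobNorm N := by
  rw [frobNorm_eq_sqrt_sum_colNorm, frobNorm_eq_sqrt_sum_colNorm, ← Real.sqrt_sq hc,
    ← Real.sqrt_mul (sq_nonneg c), Finset.mul_sum]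
  gcongr with j
  rw [← mul_pow]
  exact pow_le_pow_left₀ (colNorm_nonneg M j) (h j) 2

theorem frobNorm_mul_of_isometry [Fintype μ] [DecidableEq κ] {U : Matrix ι κ 𝕜} (hU : Uᴴ * U = 1)
    (M : Matrix κ μ 𝕜) : frobNorm (U * M) = frobNorm M := by
  simp only [frobNorm_eq_sqrt_sum_colNorm, colNorm_mul_of_isometry hU]

theorem frobNorm_submatrix_le {ι' κ' : Type*} [Fintype ι'] [Fintype κ'] (M : Matrix ι κ 𝕜)
    {e : ι' → ι} {f : κ' → κ} (he : e.Injective) (hf : f.Injective) :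
    frobNorm (M.submatrix e f) ≤ frobNorm M := by
  refine Real.sqrt_le_sqrt ?_
  rw [← Fintype.sum_prod_type', ← Fintype.sum_prod_type']
  refine le_of_eq_of_le
    (Finset.sum_map Finset.univ ⟨Prod.map e f, he.prodMap hf⟩ fun p => ‖M p.1 p.2‖ ^ 2).symm ?_
  exact Finset.sum_le_univ_sum_of_nonneg fun p => sq_nonneg _

theorem norm_mulVec_le_specNorm [DecidableEq κ] (M : Matrix ι κ 𝕜) (x : κ → 𝕜) :
    ‖M *ᵥ x‖₂ ≤ specNorm M * ‖x‖₂ :=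
  l2_opNorm_mulVec M (toLp 2 x)

open scoped Matrix.Norms.L2Operator in
theorem specNorm_nonneg [DecidableEq κ] (M : Matrix ι κ 𝕜) : 0 ≤ specNorm M := norm_nonneg M

theorem specNorm_le_frobNorm [DecidableEq κ] (M : Matrix ι κ 𝕜) : specNorm M ≤ frobNorm M := by
  rw [specNorm, l2_opNorm_def]
  exact ContinuousLinearMap.opNorm_le_bound _ (frobNorm_nonneg M) fun x => norm_mulVec_le M x.ofLp

theorem FlMatMul.colNorm_sub_le {ε : ℝ} (hε : 0 ≤ ε) {X : Matrix ι κ 𝕜} {Y : Matrix κ μ 𝕜}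
    {Z : Matrix ι μ 𝕜} (h : FlMatMul ε X Y Z) (j : μ) :
    colNorm (Z - X * Y) j ≤ relErr ε (1 + Fintype.card κ) * (frobNorm X * colNorm Y j) := by
  have entrywise : ∀ i, IsApprox ε (1 + Fintype.card κ) (‖X.row i‖₂ * ‖Y.col j‖₂)
      ((X * Y).col j i) (Z.col j i) := fun i =>
    ((h i j).isApprox hε).mono hε le_rfl (sum_norm_mul_norm_le Finset.univ (X.row i) (Y.col j))
  have rows : ‖fun i => ‖X.row i‖₂ * ‖Y.col j‖₂‖₂ = frobNorm X * ‖Y.col j‖₂ := by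
    have row_sq : ∀ i, ‖X.row i‖₂ ^ 2 = ∑ k, ‖X i k‖ ^ 2 := fun i =>
      EuclideanSpace.norm_sq_eq (toLp 2 (X.row i))
    simp only [EuclideanSpace.norm_eq (𝕜 := ℝ), norm_mul, norm_norm, mul_pow, ← Finset.sum_mul,
      row_sq]
    rw [Real.sqrt_mul' _ (sq_nonneg _), Real.sqrt_sq (norm_nonneg _), frobNorm]
  rw [colNorm_eq_norm, colNorm_eq_norm, ← rows]
  exact norm_toLp_sub_le_of_isApprox hε entrywise

end Matrices

section Reflection

variable {𝕜 : Type*} [RCLike 𝕜] {V : Type*} [NormedAddCommGroup V] [InnerProductSpace 𝕜 V]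

open Submodule

theorem reflection_orthogonal_singleton_apply (v x : V) :
    reflection (𝕜 ∙ v)ᗮ x = x - (2 * (inner 𝕜 v x / (‖v‖ : 𝕜) ^ 2)) • v := by
  rw [reflection_orthogonal_apply, reflection_singleton_apply, neg_sub, ofNat_smul_eq_nsmul,
    two_nsmul, two_mul, add_smul]

theorem reflection_sub_of_norm_eq_of_inner_comm {x y : V} (hnorm : ‖x‖ = ‖y‖)
    (hinner : inner 𝕜 x y = inner 𝕜 y x) : reflection (𝕜 ∙ (x - y))ᗮ x = y := by
  set reflect := reflection (𝕜 ∙ (x - y))ᗮ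
  have difference : reflect (x - y) = -(x - y) :=
    reflection_orthogonalComplement_singleton_eq_neg (x - y)
  have sum : reflect (x + y) = x + y := by
    apply reflection_mem_subspace_eq_self
    rw [mem_orthogonal_singleton_iff_inner_left, inner_add_left, inner_sub_right, inner_sub_right,
      inner_self_eq_norm_sq_to_K, inner_self_eq_norm_sq_to_K, hnorm, hinner]
    ring
  have twice : (2 : 𝕜) • reflect x = (2 : 𝕜) • y := by
    rw [← map_smul]
    calc reflect ((2 : 𝕜) • x) = reflect ((x + y) + (x - y)) := by
          rw [add_add_sub_cancel, ofNat_smul_eq_nsmul, two_nsmul]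
      _ = (2 : 𝕜) • y := by
          rw [map_add, sum, difference, ofNat_smul_eq_nsmul, two_nsmul]
          abel
  exact smul_right_injective V two_ne_zero twice

theorem norm_mul_norm_normalize_sub_le (u v : V) :
    ‖u‖ * ‖(‖v‖⁻¹ : 𝕜) • v - (‖u‖⁻¹ : 𝕜) • u‖ ≤ 2 * ‖v - u‖ := by
  rcases eq_or_ne v 0 with rfl | hv
  · rcases eq_or_ne u 0 with rfl | hu
    · simp
    · simp [norm_smul, hu, two_mul]
  have hv' : (‖v‖ : 𝕜) ≠ 0 := by simpa using hv
  have split : (‖u‖ : 𝕜) • ((‖v‖⁻¹ : 𝕜) • v - (‖u‖⁻¹ : 𝕜) • u) =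
      (v - u) + ((‖u‖ : 𝕜) - ‖v‖) • (‖v‖⁻¹ : 𝕜) • v := by
    rcases eq_or_ne u 0 with rfl | hu
    · simp [hv']
    have hu' : (‖u‖ : 𝕜) ≠ 0 := by simpa using hu
    rw [smul_sub, smul_inv_smul₀ hu', sub_smul, smul_inv_smul₀ hv']
    abel
  calc ‖u‖ * ‖(‖v‖⁻¹ : 𝕜) • v - (‖u‖⁻¹ : 𝕜) • u‖
      = ‖(v - u) + ((‖u‖ : 𝕜) - ‖v‖) • (‖v‖⁻¹ : 𝕜) • v‖ := by
        rw [← split, norm_smul, RCLike.norm_coe_norm]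
    _ ≤ ‖v - u‖ + |‖u‖ - ‖v‖| := by
        refine (norm_add_le _ _).trans_eq ?_
        rw [norm_smul, norm_smul, norm_inv, RCLike.norm_coe_norm,
          inv_mul_cancel₀ (norm_ne_zero_iff.2 hv), mul_one, ← RCLike.ofReal_sub,
          RCLike.norm_ofReal]
    _ ≤ 2 * ‖v - u‖ := by
        rw [two_mul, norm_sub_rev v u]
        exact add_le_add_right (abs_norm_sub_norm_le u v) _

theorem norm_inner_smul_self_sub_le {u v : V} (hu : ‖u‖ ≤ 1) (hv : ‖v‖ ≤ 1) (x : V) :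
    ‖inner 𝕜 v x • v - inner 𝕜 u x • u‖ ≤ 2 * ‖v - u‖ * ‖x‖ := by
  have split : inner 𝕜 v x • v - inner 𝕜 u x • u =
      inner 𝕜 v x • (v - u) + inner 𝕜 (v - u) x • u := by
    rw [inner_sub_left, smul_sub, sub_smul, sub_add_sub_cancel]
  calc ‖inner 𝕜 v x • v - inner 𝕜 u x • u‖
      ≤ ‖inner 𝕜 v x‖ * ‖v - u‖ + ‖inner 𝕜 (v - u) x‖ * ‖u‖ := by
        rw [split, ← norm_smul, ← norm_smul]
        exact norm_add_le _ _
    _ ≤ 1 * ‖x‖ * ‖v - u‖ + ‖v - u‖ * ‖x‖ * 1 := by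
        gcongr
        · exact (norm_inner_le_norm v x).trans (by gcongr)
        · exact norm_inner_le_norm _ x
    _ = 2 * ‖v - u‖ * ‖x‖ := by ring

theorem reflection_orthogonal_singleton_eq_normalize (v x : V) : reflection (𝕜 ∙ v)ᗮ x =
    x - (2 : 𝕜) • inner 𝕜 ((‖v‖⁻¹ : 𝕜) • v) x • (‖v‖⁻¹ : 𝕜) • v := by
  rw [reflection_orthogonal_singleton_apply, inner_smul_left, smul_smul, smul_smul, map_inv₀,
    RCLike.conj_ofReal]
  congr 2
  field_simp

theorem norm_mul_norm_reflection_sub_reflection_le (u v x : V) :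
    ‖u‖ * ‖reflection (𝕜 ∙ v)ᗮ x - reflection (𝕜 ∙ u)ᗮ x‖ ≤ 8 * ‖v - u‖ * ‖x‖ := by
  have norm_normalize_le : ∀ w : V, ‖(‖w‖⁻¹ : 𝕜) • w‖ ≤ 1 := fun w => by
    rw [norm_smul, norm_inv, RCLike.norm_coe_norm]
    exact inv_mul_le_one
  have directions_close := norm_mul_norm_normalize_sub_le (𝕜 := 𝕜) u v
  rw [reflection_orthogonal_singleton_eq_normalize, reflection_orthogonal_singleton_eq_normalize,
    sub_sub_sub_cancel_left, ← smul_sub, norm_smul, RCLike.norm_ofNat, norm_sub_rev]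
  calc ‖u‖ * (2 * ‖inner 𝕜 ((‖v‖⁻¹ : 𝕜) • v) x • (‖v‖⁻¹ : 𝕜) • v -
        inner 𝕜 ((‖u‖⁻¹ : 𝕜) • u) x • (‖u‖⁻¹ : 𝕜) • u‖)
      ≤ ‖u‖ * (2 * (2 * ‖(‖v‖⁻¹ : 𝕜) • v - (‖u‖⁻¹ : 𝕜) • u‖ * ‖x‖)) := by
        gcongr
        exact norm_inner_smul_self_sub_le (norm_normalize_le u) (norm_normalize_le v) x
    _ = 4 * (‖u‖ * ‖(‖v‖⁻¹ : 𝕜) • v - (‖u‖⁻¹ : 𝕜) • u‖) * ‖x‖ := by ring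
    _ ≤ 4 * (2 * ‖v - u‖) * ‖x‖ := by gcongr
    _ = 8 * ‖v - u‖ * ‖x‖ := by ring

end Reflection

section Householder

variable {𝕜 : Type*} [RCLike 𝕜] {ι : Type*} [Fintype ι] [DecidableEq ι]

/-- The exact Householder reflector `I - 2 v v^* / ‖v‖₂²`; it is the identity if `v = 0`. -/
def householder (v : ι → 𝕜) : Matrix ι ι 𝕜 :=
  1 - ((2 / ‖v‖₂ ^ 2 : ℝ) : 𝕜) • vecMulVec v (star v)

theorem householder_zero : householder (0 : ι → 𝕜) = 1 := by
  rw [householder, zero_vecMulVec, smul_zero, sub_zero]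

theorem householder_mulVec_apply (v x : ι → 𝕜) (i : ι) :
    (householder v *ᵥ x) i = x i - v i * (((2 / ‖v‖₂ ^ 2 : ℝ) : 𝕜) * ∑ j, star (v j) * x j) := by
  rw [householder, sub_mulVec, one_mulVec, smul_mulVec, vecMulVec_mulVec]
  simp only [Pi.sub_apply, Pi.smul_apply, MulOpposite.smul_eq_mul_unop, MulOpposite.unop_op,
    smul_eq_mul, dotProduct, Pi.star_apply]
  ring

theorem householder_mulVec_eq_self {v x : ι → 𝕜} (h : ∀ i, v i = 0 ∨ x i = 0) :
    householder v *ᵥ x = x := by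
  ext i
  rw [householder_mulVec_apply, Finset.sum_eq_zero, mul_zero, mul_zero, sub_zero]
  rintro j -
  rcases h j with hv | hx
  · rw [hv, star_zero, zero_mul]
  · rw [hx, mul_zero]

theorem toLp_householder_mulVec (v x : ι → 𝕜) :
    toLp 2 (householder v *ᵥ x) = (𝕜 ∙ toLp 2 v)ᗮ.reflection (toLp 2 x) := by
  rw [reflection_orthogonal_singleton_apply, EuclideanSpace.inner_toLp_toLp]
  ext i
  simp only [householder_mulVec_apply, PiLp.sub_apply, PiLp.smul_apply, smul_eq_mul, dotProduct,
    Pi.star_apply, mul_comm (star _)]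
  push_cast
  ring

theorem norm_mul_norm_householder_sub_le (u v x : ι → 𝕜) :
    ‖u‖₂ * ‖householder v *ᵥ x - householder u *ᵥ x‖₂ ≤ 8 * ‖v - u‖₂ * ‖x‖₂ := by
  rw [toLp_sub, toLp_householder_mulVec, toLp_householder_mulVec]
  exact norm_mul_norm_reflection_sub_reflection_le _ _ _

theorem householder_mul_self (v : ι → 𝕜) : householder v * householder v = 1 := by
  refine ext_of_mulVec_single fun _ => toLp_injective 2 ?_
  rw [← mulVec_mulVec, toLp_householder_mulVec, toLp_householder_mulVec,
    Submodule.reflection_reflection, one_mulVec]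

theorem householder_conjTranspose (v : ι → 𝕜) : (householder v)ᴴ = householder v := by
  rw [householder, conjTranspose_sub, conjTranspose_one, conjTranspose_smul,
    conjTranspose_vecMulVec, star_star, RCLike.star_def, RCLike.conj_ofReal]

theorem householder_mem_unitaryGroup (v : ι → 𝕜) : householder v ∈ unitaryGroup ι 𝕜 := by
  rw [mem_unitaryGroup_iff, star_eq_conjTranspose, householder_conjTranspose, householder_mul_self]

end Householder

section Reflector

variable {𝕜 : Type*} [RCLike 𝕜] {n : ℕ} {ε : ℝ} {k : Fin n}

/-- The column `(x(1:k-1), α, 0, …, 0)` into which a reflector acting on the coordinates `≥ k`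
transforms `x`. -/
def eliminateBelow (k : Fin n) (x : Fin n → 𝕜) (α : 𝕜) : Fin n → 𝕜 :=
  fun i => if i < k then x i else if i = k then α else 0

theorem eliminateBelow_sub (k : Fin n) (x : Fin n → 𝕜) (α β : 𝕜) :
    eliminateBelow k x α - eliminateBelow k x β = Pi.single k (α - β) := by
  ext i
  simp only [Pi.sub_apply, eliminateBelow, Pi.single_apply]
  split_ifs with below at_k at_k
  · exact absurd at_k below.ne
  all_goals simp

theorem sum_eliminateBelow {V : Type*} [AddCommMonoid V] {f : Fin n → 𝕜 → V}
    (hf : ∀ i, f i 0 = 0) (k : Fin n) (x : Fin n → 𝕜) (α : 𝕜) :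
    ∑ i, f i (eliminateBelow k x α i) = ∑ i ∈ Finset.Iio k, f i (x i) + f k α := by
  rw [← Finset.sum_subset (Finset.subset_univ (Finset.Iic k)), ← Finset.Iio_insert,
    Finset.sum_insert (by simp), add_comm]
  · congr 1
    · exact Finset.sum_congr rfl fun i hi => by simp [eliminateBelow, Finset.mem_Iio.1 hi]
    · simp [eliminateBelow]
  · intro i _ hi
    rw [Finset.mem_Iic, not_le] at hi
    simp [eliminateBelow, hi.not_gt, hi.ne', hf]

/-- The Euclidean norm of the part `x(k:n)` of the column `x`. -/
def tailNorm (k : Fin n) (x : Fin n → 𝕜) : ℝ := √(∑ i ∈ Finset.Ici k, ‖x i‖ ^ 2)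

theorem tailNorm_nonneg (k : Fin n) (x : Fin n → 𝕜) : 0 ≤ tailNorm k x := Real.sqrt_nonneg _

theorem tailNorm_sq (k : Fin n) (x : Fin n → 𝕜) :
    tailNorm k x ^ 2 = ∑ i ∈ Finset.Ici k, ‖x i‖ ^ 2 :=
  Real.sq_sqrt (Finset.sum_nonneg fun _ _ => sq_nonneg _)

theorem tailNorm_le_norm (k : Fin n) (x : Fin n → 𝕜) : tailNorm k x ≤ ‖x‖₂ := by
  rw [EuclideanSpace.norm_eq]
  exact Real.sqrt_le_sqrt (Finset.sum_le_univ_sum_of_nonneg fun i => sq_nonneg _)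

theorem norm_eliminateBelow {α : 𝕜} {x : Fin n → 𝕜} (hα : ‖α‖ = tailNorm k x) :
    ‖eliminateBelow k x α‖₂ = ‖x‖₂ := by
  rw [EuclideanSpace.norm_eq, EuclideanSpace.norm_eq,
    sum_eliminateBelow (f := fun _ a => ‖a‖ ^ 2) (by simp), hα, tailNorm_sq,
    ← Finset.sum_add_sum_compl (Finset.Iio k)]
  congr 3
  ext i
  simp

theorem inner_eliminateBelow {p : 𝕜} {x : Fin n → 𝕜} (hp : ‖p‖ = 1) (hxk : p * ‖x k‖ = x k)
    (a : ℝ) : inner 𝕜 (toLp 2 x) (toLp 2 (eliminateBelow k x (p * a))) =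
      ((∑ i ∈ Finset.Iio k, ‖x i‖ ^ 2 + a * ‖x k‖ : ℝ) : 𝕜) := by
  have hpp : p * star p = 1 := by rw [RCLike.star_def, RCLike.mul_conj, hp]; simp
  have pivot : p * a * star (x k) = ((a * ‖x k‖ : ℝ) : 𝕜) :=
    calc p * a * star (x k) = p * a * star (p * (‖x k‖ : 𝕜)) := by rw [hxk]
      _ = p * star p * (a * ‖x k‖) := by
        rw [RCLike.star_def, map_mul, RCLike.conj_ofReal]
        ring
      _ = ((a * ‖x k‖ : ℝ) : 𝕜) := by rw [hpp, one_mul, RCLike.ofReal_mul]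
  rw [EuclideanSpace.inner_toLp_toLp, dotProduct,
    sum_eliminateBelow (f := fun i b => b * star x i) (by simp), Pi.star_apply, pivot,
    RCLike.ofReal_add, RCLike.ofReal_sum]
  congr 1
  exact Finset.sum_congr rfl fun i _ => by
    rw [Pi.star_apply, RCLike.star_def, RCLike.mul_conj, RCLike.ofReal_pow]

theorem householder_sub_eliminateBelow_mulVec {p : 𝕜} {x : Fin n → 𝕜} (hp : ‖p‖ = 1)
    (hxk : p * ‖x k‖ = x k) :
    householder (x - eliminateBelow k x (-(p * tailNorm k x))) *ᵥ x =
      eliminateBelow k x (-(p * tailNorm k x)) := by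
  refine toLp_injective 2 ?_
  rw [toLp_householder_mulVec, toLp_sub]
  apply reflection_sub_of_norm_eq_of_inner_comm
  · rw [norm_eliminateBelow]
    rw [norm_neg, norm_mul, hp, one_mul, RCLike.norm_ofReal, abs_of_nonneg (tailNorm_nonneg k x)]
  · rw [← mul_neg, ← RCLike.ofReal_neg, ← inner_conj_symm _ (toLp 2 x),
      inner_eliminateBelow hp hxk, RCLike.conj_ofReal]

/-- A computed reflector `I - τ v v^*` acting on the coordinates `≥ k`: whatever the computed
vector `v` is, `τ` is relatively close to `2 / ‖v‖₂²` (which is `0` for a skipped reflection,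
where `v = 0`). -/
structure IsReflector (ε : ℝ) (k : Fin n) (v : Fin n → 𝕜) (τ : ℝ) : Prop where
  eq_zero : ∀ i < k, v i = 0
  isApprox : IsApprox ε (2 * n + 3) (2 / ‖v‖₂ ^ 2) (2 / ‖v‖₂ ^ 2) τ

theorem two_div_sq_mul_sq_le (a : ℝ) : 2 / a ^ 2 * a ^ 2 ≤ 2 := by
  rcases eq_or_ne a 0 with rfl | ha
  · norm_num
  · exact (div_mul_cancel₀ 2 (pow_ne_zero 2 ha)).le

theorem IsReflector.flApply_isApprox (hε : 0 ≤ ε) {v b y : Fin n → 𝕜} {τ : ℝ}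
    (hv : IsReflector ε k v τ) (h : FlApply ε k v τ b y) (i : Fin n) :
    IsApprox ε (3 * n + 7) (‖b i‖ + 2 / ‖v‖₂ ^ 2 * (‖v‖₂ * ‖b‖₂) * ‖v i‖)
      ((householder v *ᵥ b) i) (y i) := by
  obtain ⟨w, t, p, hw, ht, hp, hy⟩ := h
  rw [householder_mulVec_apply]
  rcases lt_or_ge i k with hi | hi
  · rw [hv.eq_zero i hi, norm_zero, mul_zero, add_zero, zero_mul, sub_zero, hy i hi]
    exact (IsApprox.refl ε (b i)).mono hε (Nat.zero_le _) le_rfl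
  have supported : ∑ j, star (v j) * b j = ∑ j ∈ Finset.Ici k, star (v j) * b j :=
    (Finset.sum_subset (Finset.subset_univ _) fun j _ hj => by
      rw [hv.eq_zero j (by simpa using hj), star_zero, zero_mul]).symm
  have dot : IsApprox ε (n + 1) (‖v‖₂ * ‖b‖₂) (∑ j, star (v j) * b j) w := by
    rw [supported]
    refine (hw.isApprox hε).mono hε ?_ ?_
    · have := (Finset.Ici k).card_le_univ
      rw [Fintype.card_fin] at this
      omega
    · simpa only [norm_star] using sum_norm_mul_norm_le (Finset.Ici k) v b
  have scale : IsApprox ε (2 * n + 3) (2 / ‖v‖₂ ^ 2) ((2 / ‖v‖₂ ^ 2 : ℝ) : 𝕜) (τ : 𝕜) :=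
    hv.isApprox.ofReal
  have scaled := (scale.mul dot).rnd ht
  have product := ((IsApprox.refl ε (v i)).mul scaled).rnd (hp i hi).1
  have difference := (((IsApprox.refl ε (b i)).mono hε (Nat.zero_le _) le_rfl).sub product).rnd
    (hp i hi).2
  exact difference.mono hε (by omega) (by rw [mul_comm ‖v i‖])

theorem IsReflector.norm_flApply_sub_le (hε : 0 ≤ ε) {v b y : Fin n → 𝕜} {τ : ℝ}
    (hv : IsReflector ε k v τ) (h : FlApply ε k v τ b y) :
    ‖y - householder v *ᵥ b‖₂ ≤ relErr ε (9 * n + 21) * ‖b‖₂ := by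
  set c := 2 / ‖v‖₂ ^ 2 * (‖v‖₂ * ‖b‖₂)
  have c_nonneg : 0 ≤ c := by positivity
  have magnitude : ‖fun i => ‖b i‖ + c * ‖v i‖‖₂ ≤ 3 * ‖b‖₂ := by
    have norm_norm_eq : ∀ x : Fin n → 𝕜, ‖fun i => ‖x i‖‖₂ = ‖x‖₂ := fun x => by
      simp only [EuclideanSpace.norm_eq, norm_norm]
    calc ‖fun i => ‖b i‖ + c * ‖v i‖‖₂
        ≤ ‖fun i => ‖b i‖‖₂ + ‖c • fun i => ‖v i‖‖₂ :=
        norm_add_le (toLp 2 fun i => ‖b i‖) (toLp 2 (c • fun i => ‖v i‖))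
      _ = ‖b‖₂ + c * ‖v‖₂ := by
        rw [toLp_smul, norm_smul, Real.norm_of_nonneg c_nonneg, norm_norm_eq, norm_norm_eq]
      _ = ‖b‖₂ + 2 / ‖v‖₂ ^ 2 * ‖v‖₂ ^ 2 * ‖b‖₂ := by ring
      _ ≤ ‖b‖₂ + 2 * ‖b‖₂ := by
        gcongr
        exact two_div_sq_mul_sq_le _
      _ = 3 * ‖b‖₂ := by ring
  calc ‖y - householder v *ᵥ b‖₂ ≤ relErr ε (3 * n + 7) * ‖fun i => ‖b i‖ + c * ‖v i‖‖₂ :=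
        norm_toLp_sub_le_of_isApprox hε (hv.flApply_isApprox hε h)
    _ ≤ relErr ε (3 * n + 7) * (3 * ‖b‖₂) := by
        gcongr
        exact relErr_nonneg hε _
    _ = 3 * relErr ε (3 * n + 7) * ‖b‖₂ := by ring
    _ ≤ relErr ε (9 * n + 21) * ‖b‖₂ := by
        gcongr
        exact mul_relErr_le hε (m := 3) (by norm_num) (by omega)

theorem FlNormSq.isApprox_Ici (hε : 0 ≤ ε) {x : Fin n → 𝕜} {σ : ℝ}
    (h : FlNormSq ε (Finset.Ici k) x σ) :
    IsApprox ε (n + 1) (tailNorm k x ^ 2) (tailNorm k x ^ 2) σ := by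
  have card_le : (Finset.Ici k).card ≤ n :=
    (Finset.card_le_univ _).trans_eq (Fintype.card_fin n)
  rw [tailNorm_sq]
  exact (h.isApprox hε).mono hε (by omega) le_rfl

theorem FlReflector.isReflector (hε : 0 ≤ ε) (hsmall : relErr ε (n + 1) ≤ 1 / 2)
    {x v : Fin n → 𝕜} {τ : ℝ} {α : 𝕜} (h : FlReflector ε k x v τ α) : IsReflector ε k v τ := by
  rcases h with ⟨-, rfl, rfl, -⟩ | ⟨-, -, -, -, ν, -, -, -, -, -, -, -, hv, -, -, hν, hτ⟩
  · exact ⟨fun _ _ => rfl, by simp [IsApprox]⟩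
  refine ⟨hv, ?_⟩
  have tailNorm_eq : tailNorm k v = ‖v‖₂ := by
    rw [EuclideanSpace.norm_eq, tailNorm]
    congr 1
    exact Finset.sum_subset (Finset.subset_univ _) fun i _ hi => by
      rw [hv i (by simpa using hi), norm_zero, zero_pow two_ne_zero]
  have inverse : IsApprox ε (2 * (n + 1)) ‖(‖v‖₂ ^ 2)⁻¹‖ (‖v‖₂ ^ 2)⁻¹ ν⁻¹ := by
    refine IsApprox.inv hε hsmall ?_
    rw [← tailNorm_eq, Real.norm_of_nonneg (sq_nonneg _)]
    exact hν.isApprox_Ici hε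
  have quotient := ((IsApprox.refl ε (2 : ℝ)).mul inverse).rnd hτ
  rw [← norm_mul, ← div_eq_mul_inv, Real.norm_of_nonneg (by positivity)] at quotient
  exact quotient.mono hε (by omega) le_rfl

theorem exists_phase_isApprox (hε : 0 ≤ ε) (hsmall : relErr ε 1 ≤ 1 / 2) {x s : 𝕜} {a : ℝ}
    (ha : Rnd ε ‖x‖ a) (hs₀ : x = 0 → s = 1) (hs : x ≠ 0 → Rnd ε (x / (a : 𝕜)) s) :
    ∃ p : 𝕜, ‖p‖ = 1 ∧ p * ‖x‖ = x ∧ IsApprox ε 3 1 p s := by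
  rcases eq_or_ne x 0 with rfl | hx
  · rw [hs₀ rfl]
    refine ⟨1, norm_one, by simp, ?_⟩
    simpa using (IsApprox.refl ε (1 : 𝕜)).mono hε (Nat.zero_le 3) le_rfl
  have norm_ne : (‖x‖ : 𝕜) ≠ 0 := by simpa using hx
  have norm_phase : ‖x * (‖x‖ : 𝕜)⁻¹‖ = 1 := by
    rw [norm_mul, norm_inv, RCLike.norm_coe_norm, mul_inv_cancel₀ (norm_ne_zero_iff.2 hx)]
  have modulus : IsApprox ε 1 ‖(‖x‖ : 𝕜)‖ (‖x‖ : 𝕜) (a : 𝕜) :=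
    (ha.isApprox (by simp)).ofReal
  have quotient := (IsApprox.refl ε x).mul (modulus.inv hε hsmall)
  rw [← norm_mul, norm_phase, ← div_eq_mul_inv x (a : 𝕜)] at quotient
  exact ⟨x * (‖x‖ : 𝕜)⁻¹, norm_phase, inv_mul_cancel_right₀ norm_ne x,
    (quotient.rnd (hs hx)).mono hε (by norm_num) le_rfl⟩

theorem eq_eliminateBelow {x y : Fin n → 𝕜} (above : ∀ i < k, y i = x i)
    (below : ∀ i, k < i → y i = 0) : y = eliminateBelow k x (y k) := by
  ext i
  rcases lt_trichotomy i k with hi | rfl | hi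
  · simp [eliminateBelow, hi, above i hi]
  · simp [eliminateBelow]
  · simp [eliminateBelow, hi.not_gt, hi.ne', below i hi]

theorem sub_sub_eliminateBelow {x v : Fin n → 𝕜} {α : 𝕜} (hv_lt : ∀ i, i < k → v i = 0)
    (hv_gt : ∀ i, k < i → v i = x i) :
    v - (x - eliminateBelow k x α) = Pi.single k (v k - (x k - α)) := by
  ext i
  rcases lt_trichotomy i k with hi | rfl | hi
  · simp [eliminateBelow, hi, hi.ne, hv_lt i hi]
  · simp [eliminateBelow]
  · simp [eliminateBelow, hi.not_gt, hi.ne', hv_gt i hi]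

theorem norm_householder_sub_eliminateBelow_le (hε : 0 ≤ ε) {p : 𝕜} {x v : Fin n → 𝕜}
    {l : ℕ} (hp : ‖p‖ = 1) (hxk : p * ‖x k‖ = x k) (hx : ∃ i, k ≤ i ∧ x i ≠ 0)
    (hv_lt : ∀ i, i < k → v i = 0) (hv_gt : ∀ i, k < i → v i = x i)
    (hvk : IsApprox ε l (‖x k‖ + tailNorm k x) (x k - -(p * tailNorm k x)) (v k)) :
    ‖householder v *ᵥ x - eliminateBelow k x (-(p * tailNorm k x))‖₂ ≤ 8 * relErr ε l * ‖x‖₂ := by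
  set u := x - eliminateBelow k x (-(p * tailNorm k x)) with u_def
  have tail_pos : 0 < tailNorm k x := by
    obtain ⟨i, hi, hxi⟩ := hx
    exact Real.sqrt_pos.2 (Finset.sum_pos' (fun j _ => sq_nonneg _)
      ⟨i, Finset.mem_Ici.2 hi, by positivity⟩)
  have uk_le : ‖x k‖ + tailNorm k x ≤ ‖u‖₂ := by
    refine le_of_eq_of_le ?_ (norm_apply_le_norm_toLp u k)
    have uk : u k = p * ((‖x k‖ + tailNorm k x : ℝ) : 𝕜) := by
      rw [RCLike.ofReal_add, mul_add, hxk]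
      simp [u_def, eliminateBelow]
    rw [uk, norm_mul, hp, one_mul, RCLike.norm_of_nonneg (by positivity)]
  have u_pos : 0 < ‖u‖₂ := by linarith [norm_nonneg (x k)]
  have v_close : ‖v - u‖₂ ≤ relErr ε l * ‖u‖₂ := by
    rw [u_def, sub_sub_eliminateBelow hv_lt hv_gt, ← u_def]
    exact (PiLp.norm_single 2 (fun _ => 𝕜) k _).trans_le (hvk.2.trans
      (mul_le_mul_of_nonneg_left uk_le (relErr_nonneg hε l)))
  have reflects : householder u *ᵥ x = eliminateBelow k x (-(p * tailNorm k x)) :=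
    householder_sub_eliminateBelow_mulVec hp hxk
  rw [← reflects]
  refine le_of_mul_le_mul_left ?_ u_pos
  calc ‖u‖₂ * ‖householder v *ᵥ x - householder u *ᵥ x‖₂ ≤ 8 * ‖v - u‖₂ * ‖x‖₂ :=
        norm_mul_norm_householder_sub_le u v x
    _ ≤ 8 * (relErr ε l * ‖u‖₂) * ‖x‖₂ := by gcongr
    _ = ‖u‖₂ * (8 * relErr ε l * ‖x‖₂) := by ring

theorem FlReflector.norm_eliminateBelow_sub_le (hε : 0 ≤ ε) (hsmall : relErr ε (n + 1) ≤ 1 / 2)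
    {x v : Fin n → 𝕜} {τ : ℝ} {α : 𝕜} (h : FlReflector ε k x v τ α) :
    ‖eliminateBelow k x α - householder v *ᵥ x‖₂ ≤ relErr ε (9 * n + 63) * ‖x‖₂ := by
  rcases h with ⟨hx, rfl, -, rfl⟩ |
    ⟨hx, σ, ρ, a, -, s, hσ, hρ, ha, hs₀, hs, hα, hv_lt, hvk, hv_gt, -, -⟩
  · rw [← eq_eliminateBelow (fun _ _ => rfl) hx, householder_zero, one_mulVec, sub_self,
      toLp_zero, norm_zero]
    exact mul_nonneg (relErr_nonneg hε _) (norm_nonneg _)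
  obtain ⟨p, hp, hxk, phase_close⟩ :=
    exists_phase_isApprox hε ((relErr_mono hε (by omega)).trans hsmall) ha hs₀ hs
  have root := IsApprox.sqrt (by linarith) (sq_nonneg _) (hσ.isApprox_Ici hε)
  rw [Real.sqrt_sq (tailNorm_nonneg k x)] at root
  have pivot_close : IsApprox ε (n + 6) (tailNorm k x) (-(p * tailNorm k x)) α := by
    have := (phase_close.mul (root.rnd hρ).ofReal).neg.rnd hα
    rw [one_mul] at this
    exact this.mono hε (by omega) le_rfl
  have vk_close : IsApprox ε (n + 7) (‖x k‖ + tailNorm k x) (x k - -(p * tailNorm k x)) (v k) :=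
    (((IsApprox.refl ε (x k)).mono hε (Nat.zero_le _) le_rfl).sub pivot_close).rnd hvk
  calc ‖eliminateBelow k x α - householder v *ᵥ x‖₂
      ≤ ‖eliminateBelow k x α - eliminateBelow k x (-(p * tailNorm k x))‖₂ +
        ‖eliminateBelow k x (-(p * tailNorm k x)) - householder v *ᵥ x‖₂ :=
        norm_sub_le_norm_sub_add_norm_sub (toLp 2 _) (toLp 2 _) (toLp 2 _)
    _ ≤ relErr ε (n + 7) * ‖x‖₂ + 8 * relErr ε (n + 7) * ‖x‖₂ := by
        gcongr
        · rw [eliminateBelow_sub]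
          exact (PiLp.norm_single 2 (fun _ => 𝕜) k _).trans_le (pivot_close.2.trans
            (mul_le_mul (relErr_mono hε (by omega)) (tailNorm_le_norm k x) (tailNorm_nonneg k x)
              (relErr_nonneg hε _)))
        · rw [toLp_sub, norm_sub_rev, ← toLp_sub]
          exact norm_householder_sub_eliminateBelow_le hε hp hxk hx hv_lt hv_gt vk_close
    _ = 9 * relErr ε (n + 7) * ‖x‖₂ := by ring
    _ ≤ relErr ε (9 * n + 63) * ‖x‖₂ := by
        gcongr
        exact mul_relErr_le hε (m := 9) (by norm_num) (by omega)

end Reflector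

section Accumulation

variable {𝕜 : Type*} [RCLike 𝕜] {n m : ℕ} {ε : ℝ} {v : Fin n → Fin n → 𝕜} {τ : Fin n → ℝ}

/-- The product `H_0 H_1 ⋯ H_{k-1}` of the exact Householder reflectors with vectors `v`;
indices `≥ n` contribute the identity. -/
def householderProd (v : Fin n → Fin n → 𝕜) : ℕ → Matrix (Fin n) (Fin n) 𝕜
  | 0 => 1
  | k + 1 => householderProd v k * if h : k < n then householder (v ⟨k, h⟩) else 1

theorem householderProd_succ (v : Fin n → Fin n → 𝕜) (k : Fin n) :
    householderProd v (k + 1) = householderProd v k * householder (v k) := by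
  rw [householderProd, dif_pos k.2]

theorem householderProd_mem_unitaryGroup (v : Fin n → Fin n → 𝕜) (k : ℕ) :
    householderProd v k ∈ unitaryGroup (Fin n) 𝕜 := by
  induction k with
  | zero => exact one_mem _
  | succ k ih =>
    rw [householderProd]
    refine mul_mem ih ?_
    split_ifs
    · exact householder_mem_unitaryGroup _
    · exact one_mem _

theorem norm_householderProd_mulVec (v : Fin n → Fin n → 𝕜) (k : ℕ) (x : Fin n → 𝕜) :
    ‖householderProd v k *ᵥ x‖₂ = ‖x‖₂ :=
  norm_mulVec_of_isometry (mem_unitaryGroup_iff'.1 (householderProd_mem_unitaryGroup v k)) x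

theorem norm_householderProd_mulVec_sub_le (hε : 0 ≤ ε) {l : ℕ} (hm : m ≤ n)
    {w : ℕ → Fin n → 𝕜} (step : ∀ k : Fin n, (k : ℕ) < m →
      ‖w (k + 1) - householder (v k) *ᵥ w k‖₂ ≤ relErr ε l * ‖w k‖₂) :
    ‖householderProd v m *ᵥ w m - w 0‖₂ ≤ relErr ε (m * l) * ‖w 0‖₂ := by
  have accumulated := norm_sub_le_relErr_of_forall_step hε
    (a := fun k => toLp 2 (householderProd v k *ᵥ w k)) (m := m) (k := l) fun k hk => by
      have hkn : k < n := by omega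
      have difference : householderProd v (k + 1) *ᵥ w (k + 1) - householderProd v k *ᵥ w k =
          householderProd v (k + 1) *ᵥ (w (k + 1) - householder (v ⟨k, hkn⟩) *ᵥ w k) := by
        rw [mulVec_sub, mulVec_mulVec, householderProd_succ v ⟨k, hkn⟩, mul_assoc,
          householder_mul_self, mul_one]
      rw [← toLp_sub, difference, norm_householderProd_mulVec, norm_householderProd_mulVec]
      exact step ⟨k, hkn⟩ hk
  simpa only [← toLp_sub, householderProd, one_mulVec] using accumulated

theorem norm_sub_householderProd_mulVec_le (hε : 0 ≤ ε) {l : ℕ} (hm : m ≤ n)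
    {w : ℕ → Fin n → 𝕜} (step : ∀ k : Fin n, (k : ℕ) < m →
      ‖w k - householder (v k) *ᵥ w (k + 1)‖₂ ≤ relErr ε l * ‖w (k + 1)‖₂) :
    ‖w 0 - householderProd v m *ᵥ w m‖₂ ≤ relErr ε (m * l) * ‖w m‖₂ := by
  have accumulated := norm_sub_le_relErr_of_forall_step hε
    (a := fun k => toLp 2 (householderProd v (m - k) *ᵥ w (m - k))) (m := m) (k := l)
    fun k hk => by
      have hkn : m - (k + 1) < n := by omega
      have succ_eq : m - k = m - (k + 1) + 1 := by omega
      rw [← toLp_sub, succ_eq, householderProd_succ v ⟨m - (k + 1), hkn⟩, ← mulVec_mulVec,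
        ← mulVec_sub, norm_householderProd_mulVec, mulVec_mulVec,
        ← householderProd_succ v ⟨m - (k + 1), hkn⟩, norm_householderProd_mulVec]
      exact step ⟨m - (k + 1), hkn⟩ (by simp only; omega)
  simpa only [← toLp_sub, Nat.sub_self, Nat.sub_zero, householderProd, one_mulVec,
    norm_householderProd_mulVec] using accumulated

theorem FlApplyAdjoint.colNorm_sub_le (hε : 0 ≤ ε) (hm : m ≤ n)
    (hv : ∀ k : Fin n, (k : ℕ) < m → IsReflector ε k (v k) (τ k))
    {M X : Matrix (Fin n) (Fin n) 𝕜} (h : FlApplyAdjoint ε m v τ M X) (j : Fin n) :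
    colNorm (householderProd v m * X - M) j ≤ relErr ε (m * (9 * n + 21)) * colNorm M j := by
  obtain ⟨Z, rfl, rfl, step⟩ := h
  rw [colNorm_eq_norm, colNorm_eq_norm]
  exact norm_householderProd_mulVec_sub_le hε hm (w := fun k => (Z k).col j)
    fun k hk => (hv k hk).norm_flApply_sub_le hε (step k hk j)

theorem FlFormQ.colNorm_sub_le (hε : 0 ≤ ε) (hm : m ≤ n)
    (hv : ∀ k : Fin n, (k : ℕ) < m → IsReflector ε k (v k) (τ k))
    {Q : Matrix (Fin n) (Fin n) 𝕜} (h : FlFormQ ε m v τ Q) (j : Fin n) :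
    colNorm (Q - householderProd v m) j ≤
      relErr ε (m * (9 * n + 21)) * colNorm (1 : Matrix (Fin n) (Fin n) 𝕜) j := by
  obtain ⟨P, hPm, rfl, step⟩ := h
  have accumulated := norm_sub_householderProd_mulVec_le hε hm (w := fun k => (P k).col j)
    fun k hk => (hv k hk).norm_flApply_sub_le hε (step k hk j)
  have product : householderProd v m = householderProd v m * P m := by rw [hPm, mul_one]
  rw [product, ← hPm, colNorm_eq_norm, colNorm_eq_norm]
  exact accumulated

theorem FlHouseholderQR.eq_zero_below_diagonal (hm : m ≤ n) {M T : Matrix (Fin n) (Fin n) 𝕜}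
    (h : FlHouseholderQR ε m M v τ T) {i j : Fin n} (hj : (j : ℕ) < m) (hij : j < i) :
    T i j = 0 := by
  induction m generalizing T with
  | zero => omega
  | succ m ih =>
    obtain ⟨W, hW, rfl, step⟩ := h
    obtain ⟨unchanged, -, -, eliminated, -⟩ := step ⟨m, hm⟩ (Nat.lt_succ_self m)
    rcases Nat.lt_succ_iff_lt_or_eq.1 hj with hj | rfl
    · rw [unchanged j hj i]
      exact ih (by omega) ⟨W, hW, rfl, fun k hk => step k (by omega)⟩ hj
    · exact eliminated i hij

theorem FlHouseholderQR.isReflector (hε : 0 ≤ ε) (hsmall : relErr ε (n + 1) ≤ 1 / 2)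
    {M T : Matrix (Fin n) (Fin n) 𝕜} (h : FlHouseholderQR ε m M v τ T) (k : Fin n)
    (hk : (k : ℕ) < m) : IsReflector ε k (v k) (τ k) := by
  obtain ⟨W, -, -, step⟩ := h
  exact (step k hk).2.1.isReflector hε hsmall

theorem FlHouseholderQR.colNorm_sub_le (hε : 0 ≤ ε) (hsmall : relErr ε (n + 1) ≤ 1 / 2)
    (hm : m ≤ n) {M T : Matrix (Fin n) (Fin n) 𝕜} (h : FlHouseholderQR ε m M v τ T)
    (j : Fin n) :
    colNorm (householderProd v m * T - M) j ≤ relErr ε (m * (9 * n + 63)) * colNorm M j := by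
  have hv := h.isReflector hε hsmall
  obtain ⟨W, rfl, rfl, step⟩ := h
  rw [colNorm_eq_norm, colNorm_eq_norm]
  refine norm_householderProd_mulVec_sub_le hε hm (w := fun k => (W k).col j) fun k hk => ?_
  obtain ⟨unchanged, reflector, above, below, apply⟩ := step k hk
  rcases lt_trichotomy j k with hj | rfl | hj
  · have column_zero : ∀ i, k ≤ i → (W k).col j i = 0 := fun i hi =>
      FlHouseholderQR.eq_zero_below_diagonal (M := W 0) k.2.le
        ⟨W, rfl, rfl, fun l hl => step l (hl.trans hk)⟩ hj (hj.trans_le hi)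
    have fixed : (W (k + 1)).col j = householder (v k) *ᵥ (W k).col j := by
      rw [householder_mulVec_eq_self fun i => (lt_or_ge i k).imp ((hv k hk).eq_zero i)
        (column_zero i)]
      exact funext (unchanged j hj)
    rw [fixed, sub_self, toLp_zero, norm_zero]
    exact mul_nonneg (relErr_nonneg hε _) (norm_nonneg _)
  · have pivot : (W (j + 1)).col j = eliminateBelow j ((W j).col j) (W (j + 1) j j) :=
      eq_eliminateBelow above below
    rw [pivot]
    exact reflector.norm_eliminateBelow_sub_le hε hsmall
  · refine ((hv k hk).norm_flApply_sub_le hε (apply j hj)).trans ?_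
    exact mul_le_mul_of_nonneg_right (relErr_mono hε (by omega)) (norm_nonneg _)

end Accumulation

section NearIsometry

variable {𝕜 : Type*} [RCLike 𝕜] {ι κ μ : Type*} [Fintype ι] [Fintype κ] [DecidableEq κ] {δ θ : ℝ}

theorem one_sub_mul_norm_le {U Q : Matrix ι κ 𝕜} (hU : Uᴴ * U = 1) (hQ : frobNorm (Q - U) ≤ δ)
    (x : κ → 𝕜) : (1 - δ) * ‖x‖₂ ≤ ‖Q *ᵥ x‖₂ := by
  have perturbation : ‖Q *ᵥ x - U *ᵥ x‖₂ ≤ δ * ‖x‖₂ := by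
    rw [← sub_mulVec]
    exact (norm_mulVec_le _ x).trans (mul_le_mul_of_nonneg_right hQ (norm_nonneg _))
  have triangle := norm_le_norm_add_norm_sub (toLp 2 (Q *ᵥ x)) (toLp 2 (U *ᵥ x))
  rw [norm_mulVec_of_isometry hU, ← toLp_sub] at triangle
  linarith

theorem isUnit_det_of_near_isometry {U Q : Matrix κ κ 𝕜} (hU : Uᴴ * U = 1)
    (hQ : frobNorm (Q - U) ≤ δ) (hδ : δ < 1) : IsUnit Q.det := by
  rw [← isUnit_iff_isUnit_det, ← mulVec_injective_iff_isUnit]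
  refine (injective_iff_map_eq_zero Q.mulVecLin).2 fun x hx => ?_
  have bound := one_sub_mul_norm_le hU hQ x
  rw [← mulVecLin_apply, hx, toLp_zero, norm_zero] at bound
  exact (toLp_eq_zero 2).1 (norm_le_zero_iff.1 (nonpos_of_mul_nonpos_right bound (by linarith)))

theorem exists_eq_mul_add_of_near_isometry {U Q : Matrix κ κ 𝕜} (hU : Uᴴ * U = 1)
    (hQ : frobNorm (Q - U) ≤ δ) (hδ : δ < 1) {M X : Matrix κ μ 𝕜}
    (hX : ∀ j, colNorm (X - U * M) j ≤ θ * colNorm M j) :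
    ∃ dM, X = Q * (M + dM) ∧ ∀ j, (1 - δ) * colNorm dM j ≤ (θ + δ) * colNorm M j := by
  have hQX : Q * (Q⁻¹ * X) = X :=
    mul_nonsing_inv_cancel_left Q X (isUnit_det_of_near_isometry hU hQ hδ)
  refine ⟨Q⁻¹ * X - M, by rw [add_sub_cancel, hQX], fun j => ?_⟩
  have residual : Q * (Q⁻¹ * X - M) = X - Q * M := by rw [Matrix.mul_sub, hQX]
  calc (1 - δ) * colNorm (Q⁻¹ * X - M) j ≤ colNorm (Q * (Q⁻¹ * X - M)) j := by
        rw [colNorm_eq_norm, colNorm_eq_norm]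
        exact one_sub_mul_norm_le hU hQ ((Q⁻¹ * X - M).col j)
    _ ≤ colNorm (X - U * M) j + colNorm (U * M - Q * M) j := residual ▸ colNorm_sub_le_add _ _ _ j
    _ ≤ θ * colNorm M j + δ * colNorm M j := by
        rw [colNorm_sub_rev (U * M), ← Matrix.sub_mul]
        exact add_le_add (hX j) ((colNorm_mul_le _ M j).trans
          (mul_le_mul_of_nonneg_right hQ (colNorm_nonneg M j)))
    _ = (θ + δ) * colNorm M j := by ring

end NearIsometry

section ErrorLevel

variable {𝕜 : Type*} [RCLike 𝕜] {n m : ℕ} {ε : ℝ} {v : Fin n → Fin n → 𝕜} {τ : Fin n → ℝ}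

theorem sqrt_natCast_le (n : ℕ) : √(n : ℝ) ≤ n :=
  Real.sqrt_le_iff.2 ⟨n.cast_nonneg, by exact_mod_cast Nat.le_self_pow two_ne_zero n⟩

/-- The error level of an `n × n` Householder QR factorization in precision `ε`: `63 (n + 1) ^ 3`
accumulated roundings. It bounds the columnwise backward error of the factorization, and the
departure of the computed unitary factor from a unitary matrix. -/
def qrErr (ε : ℝ) (n : ℕ) : ℝ := relErr ε (63 * (n + 1) ^ 3)

theorem qrErr_nonneg (hε : 0 ≤ ε) (n : ℕ) : 0 ≤ qrErr ε n := relErr_nonneg hε _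

theorem qrErr_mul_le (hε : 0 ≤ ε) (hsmall : 756 * ((n : ℝ) + 1) ^ 4 * ε ≤ 1) :
    qrErr ε n * (4 * √n + 6) ≤ 756 * ((n : ℝ) + 1) ^ 4 * ε := by
  have one_le : (1 : ℝ) ≤ n + 1 := by simp
  have cube_le : ((n : ℝ) + 1) ^ 3 * ε ≤ (n + 1) ^ 4 * ε :=
    mul_le_mul_of_nonneg_right (pow_le_pow_right₀ one_le (by norm_num)) hε
  have linear : qrErr ε n ≤ 126 * ((n : ℝ) + 1) ^ 3 * ε := by
    refine (relErr_le_two_mul hε (63 * (n + 1) ^ 3) ?_).trans_eq ?_ <;> push_cast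
    · linarith
    · ring
  calc qrErr ε n * (4 * √n + 6) ≤ 126 * ((n : ℝ) + 1) ^ 3 * ε * (6 * (n + 1)) := by
        gcongr
        linarith [sqrt_natCast_le n, n.cast_nonneg (α := ℝ)]
    _ = 756 * ((n : ℝ) + 1) ^ 4 * ε := by ring

theorem relErr_le_qrErr (hε : 0 ≤ ε) {k : ℕ} (hk : k ≤ 63 * (n + 1) ^ 2) :
    relErr ε k ≤ qrErr ε n :=
  relErr_mono hε (by nlinarith [Nat.zero_le ((n + 1) ^ 2 * n)])

theorem sqrt_add_one_mul_relErr_le_qrErr (hε : 0 ≤ ε) {k : ℕ} (hk : k ≤ 63 * (n + 1) ^ 2) :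
    (√n + 1) * relErr ε k ≤ qrErr ε n := by
  refine mul_relErr_le hε (m := n + 1) ?_ (by nlinarith)
  push_cast
  exact add_le_add_left (sqrt_natCast_le n) 1

theorem FlHouseholderQR.isReflector_of_qrErr (hε : 0 ≤ ε) (hsmall : qrErr ε n ≤ 1 / 2)
    {M T : Matrix (Fin n) (Fin n) 𝕜} (h : FlHouseholderQR ε m M v τ T) (k : Fin n)
    (hk : (k : ℕ) < m) : IsReflector ε k (v k) (τ k) :=
  h.isReflector hε ((relErr_le_qrErr hε (by nlinarith)).trans hsmall) k hk

theorem FlHouseholderQR.colNorm_sub_le_qrErr (hε : 0 ≤ ε) (hsmall : qrErr ε n ≤ 1 / 2)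
    (hm : m ≤ n) {M T : Matrix (Fin n) (Fin n) 𝕜} (h : FlHouseholderQR ε m M v τ T)
    (j : Fin n) :
    colNorm (householderProd v m * T - M) j ≤ qrErr ε n * colNorm M j :=
  (h.colNorm_sub_le hε ((relErr_le_qrErr hε (by nlinarith)).trans hsmall) hm j).trans
    (mul_le_mul_of_nonneg_right (relErr_le_qrErr hε (by nlinarith)) (colNorm_nonneg M j))

theorem FlFormQ.frobNorm_sub_le_qrErr (hε : 0 ≤ ε) (hm : m ≤ n)
    (hv : ∀ k : Fin n, (k : ℕ) < m → IsReflector ε k (v k) (τ k))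
    {Q : Matrix (Fin n) (Fin n) 𝕜} (h : FlFormQ ε m v τ Q) :
    frobNorm (Q - householderProd v m) ≤ qrErr ε n :=
  calc frobNorm (Q - householderProd v m) ≤ relErr ε (m * (9 * n + 21)) * √n := by
        simpa only [frobNorm_one, Fintype.card_fin] using
          frobNorm_le_of_colNorm_le (relErr_nonneg hε _) (h.colNorm_sub_le hε hm hv)
    _ ≤ (√n + 1) * relErr ε (m * (9 * n + 21)) := by linarith [relErr_nonneg hε (m * (9 * n + 21))]
    _ ≤ qrErr ε n := sqrt_add_one_mul_relErr_le_qrErr hε (by nlinarith)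

theorem frobNorm_le_sqrt_add_one {Q U : Matrix (Fin n) (Fin n) 𝕜}
    (hU : U ∈ unitaryGroup (Fin n) 𝕜) (hQ : frobNorm (Q - U) ≤ 1) : frobNorm Q ≤ √n + 1 := by
  have frobNorm_unitary : frobNorm U = √n := by
    rw [← mul_one U, frobNorm_mul_of_isometry (mem_unitaryGroup_iff'.1 hU), frobNorm_one,
      Fintype.card_fin]
  linarith [frobNorm_le_add_sub Q U]

theorem FlMatMul.colNorm_sub_le_qrErr {ι κ μ : Type*} [Fintype ι] [Fintype κ] (hε : 0 ≤ ε)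
    (hκ : Fintype.card κ ≤ n) {V W : Matrix ι κ 𝕜} {M : Matrix κ μ 𝕜} {X : Matrix ι μ 𝕜}
    (hV : frobNorm V ≤ √n + 1) (hVW : frobNorm (V - W) ≤ qrErr ε n) (h : FlMatMul ε V M X)
    (j : μ) : colNorm (X - W * M) j ≤ 2 * qrErr ε n * colNorm M j := by
  have hM := colNorm_nonneg M j
  have hγ := relErr_nonneg hε (1 + Fintype.card κ)
  calc colNorm (X - W * M) j ≤ colNorm (X - V * M) j + colNorm ((V - W) * M) j := by
        rw [Matrix.sub_mul]
        exact colNorm_sub_le_add _ _ _ j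
    _ ≤ relErr ε (1 + Fintype.card κ) * (frobNorm V * colNorm M j) +
          frobNorm (V - W) * colNorm M j :=
        add_le_add (h.colNorm_sub_le hε j) (colNorm_mul_le _ M j)
    _ ≤ relErr ε (1 + Fintype.card κ) * ((√n + 1) * colNorm M j) + qrErr ε n * colNorm M j := by
        gcongr
    _ = ((√n + 1) * relErr ε (1 + Fintype.card κ) + qrErr ε n) * colNorm M j := by ring
    _ ≤ 2 * qrErr ε n * colNorm M j := by
        have level := sqrt_add_one_mul_relErr_le_qrErr (n := n) hε (k := 1 + Fintype.card κ)
          (by nlinarith)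
        gcongr
        linarith

theorem FlApplyAdjoint.colNorm_sub_le_qrErr (hε : 0 ≤ ε) (hm : m ≤ n)
    (hv : ∀ k : Fin n, (k : ℕ) < m → IsReflector ε k (v k) (τ k))
    {M X : Matrix (Fin n) (Fin n) 𝕜} (h : FlApplyAdjoint ε m v τ M X) (j : Fin n) :
    colNorm (X - (householderProd v m)ᴴ * M) j ≤ qrErr ε n * colNorm M j := by
  have hU := mem_unitaryGroup_iff'.1 (householderProd_mem_unitaryGroup v m)
  have hU' := mem_unitaryGroup_iff.1 (householderProd_mem_unitaryGroup v m)
  rw [star_eq_conjTranspose] at hU hU'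
  rw [← colNorm_mul_of_isometry hU, Matrix.mul_sub, ← Matrix.mul_assoc, hU', Matrix.one_mul]
  exact (h.colNorm_sub_le hε hm hv j).trans
    (mul_le_mul_of_nonneg_right (relErr_le_qrErr hε (by nlinarith)) (colNorm_nonneg M j))

end ErrorLevel

section Deflation

variable {𝕜 : Type*} [RCLike 𝕜] {n r : ℕ} {κ ι : Type*}

theorem mul_stack (hr : r ≤ n) (M : Matrix ι (Fin n) 𝕜) (X : Matrix (Fin (n - r)) κ 𝕜)
    (R : Matrix (Fin r) κ 𝕜) : M * stack hr X R = omega₁ hr M * X + omega₂ hr M * R := by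
  ext i j
  rw [Matrix.mul_apply, ← (stackEquiv hr).sum_comp, Fintype.sum_sum_type]
  simp [stack, omega₁, omega₂, Matrix.mul_apply]

theorem stack_add (hr : r ≤ n) (X X' : Matrix (Fin (n - r)) κ 𝕜) (R R' : Matrix (Fin r) κ 𝕜) :
    stack hr (X + X') (R + R') = stack hr X R + stack hr X' R' := by
  ext i j
  obtain ⟨i, rfl⟩ := (stackEquiv hr).surjective i
  rcases i with i | i <;> simp [stack]

theorem mul_omega₁ [Fintype ι] (hr : r ≤ n) (M : Matrix κ ι 𝕜) (N : Matrix ι (Fin n) 𝕜) :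
    M * omega₁ hr N = omega₁ hr (M * N) := rfl

theorem mul_omega₂ [Fintype ι] (hr : r ≤ n) (M : Matrix κ ι 𝕜) (N : Matrix ι (Fin n) 𝕜) :
    M * omega₂ hr N = omega₂ hr (M * N) := rfl

theorem conj_linA {Q : Matrix (Fin n) (Fin n) 𝕜} (hQ : Qᴴ * Q = 1)
    (B D E : Matrix (Fin n) (Fin n) 𝕜) :
    (fromBlocks (fromBlocks 1 0 0 Qᴴ) 0 0 (fromBlocks 1 0 0 Qᴴ) * linA B D E *
        fromBlocks 1 0 0 (fromBlocks 1 0 0 Q) : Matrix (LinIdx n) (LinIdx n) 𝕜) =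
      linA B (Qᴴ * D) (Qᴴ * E) := by
  simp [linA, fromBlocks_multiply, hQ, ← fromBlocks_one, fromBlocks_neg]

theorem conj_linB {Q : Matrix (Fin n) (Fin n) 𝕜} (hQ : Qᴴ * Q = 1)
    (A C : Matrix (Fin n) (Fin n) 𝕜) :
    (fromBlocks (fromBlocks 1 0 0 Qᴴ) 0 0 (fromBlocks 1 0 0 Qᴴ) * linB A C *
        fromBlocks 1 0 0 (fromBlocks 1 0 0 Q) : Matrix (LinIdx n) (LinIdx n) 𝕜) =
      fromBlocks (fromBlocks (-A) 0 (-(Qᴴ * C)) (-Qᴴ)) 0 0 (-1) := by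
  simp [linB, fromBlocks_multiply, hQ, ← fromBlocks_one, fromBlocks_neg]

theorem linA_submatrix_rowPerm_colPart (hr : r ≤ n) (B D : Matrix (Fin n) (Fin n) 𝕜)
    {E : Matrix (Fin n) (Fin n) 𝕜} (hE : botRows hr E = 0) :
    (linA B D E).submatrix (rowPerm hr) (colPart hr) =
      fromBlocks (redA B (topRows hr D) (stack hr (botRows hr D) (topRows hr E)))
        (fromRows 0 (-omega₁ hr 1)) 0 0 := by
  have E_bot : ∀ i j, E (splitEquiv hr (Sum.inr i)) j = 0 := fun i j => congrFun₂ hE i j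
  ext i j
  rcases i with (((i | i | i) | i) | i)
  case inl.inr =>
    obtain ⟨i, rfl⟩ := (stackEquiv hr).surjective i
    rcases i with i | i <;> rcases j with (((j | j) | j | j) | j) <;>
      simp [rowPerm, colPart, linA, redA, one_apply, topRows, botRows, stack, omega₁]
  all_goals rcases j with (((j | j) | j | j) | j) <;>
    simp [rowPerm, colPart, linA, redA, one_apply, topRows, E_bot]

theorem linB_submatrix_rowPerm_colPart (hr : r ≤ n) (A C U : Matrix (Fin n) (Fin n) 𝕜) :
    (fromBlocks (fromBlocks (-A) 0 (-C) (-U)) 0 0 (-1) :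
        Matrix (LinIdx n) (LinIdx n) 𝕜).submatrix (rowPerm hr) (colPart hr) =
      fromBlocks (redB A (topRows hr C) (topRows hr U) (stack hr (botRows hr C) 0)
        (stack hr (botRows hr U) 0) 0 (-omega₂ hr 1)) 0 0 (-1) := by
  ext i j
  rcases i with (((i | i | i) | i) | i)
  case inl.inr =>
    obtain ⟨i, rfl⟩ := (stackEquiv hr).surjective i
    rcases i with i | i <;> rcases j with (((j | j) | j | j) | j) <;>
      simp [rowPerm, colPart, redB, one_apply, botRows, stack, omega₂]
  all_goals rcases j with (((j | j) | j | j) | j) <;>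
    simp [rowPerm, colPart, redB, one_apply, topRows]

theorem deflationTransform_linA (hr : r ≤ n) {QE : Matrix (Fin n) (Fin n) 𝕜} (hQE : QEᴴ * QE = 1)
    (Q₂ B D : Matrix (Fin n) (Fin n) 𝕜) {E : Matrix (Fin n) (Fin n) 𝕜}
    (hE : botRows hr (QEᴴ * E) = 0) :
    deflationTransform hr QE Q₂ (linA B D E) =
      fromBlocks (redA B (topRows hr (QEᴴ * D))
        (Q₂ᴴ * stack hr (botRows hr (QEᴴ * D)) (topRows hr (QEᴴ * E))))
        (fromRows 0 (-omega₁ hr Q₂ᴴ)) 0 0 := by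
  rw [deflationTransform, conj_linA hQE, linA_submatrix_rowPerm_colPart hr B _ hE, redA, redA]
  simp [fromBlocks_multiply, fromBlocks_mul_fromRows, mul_fromCols, mul_omega₁]

theorem deflationTransform_linB (hr : r ≤ n) {QE : Matrix (Fin n) (Fin n) 𝕜} (hQE : QEᴴ * QE = 1)
    (Q₂ A C : Matrix (Fin n) (Fin n) 𝕜) :
    deflationTransform hr QE Q₂ (linB A C) =
      fromBlocks (redB A (topRows hr (QEᴴ * C)) (topRows hr QEᴴ)
        (omega₁ hr Q₂ᴴ * botRows hr (QEᴴ * C)) (omega₁ hr Q₂ᴴ * botRows hr QEᴴ) 0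
        (-omega₂ hr Q₂ᴴ)) 0 0 (-1) := by
  rw [deflationTransform, conj_linB hQE, linB_submatrix_rowPerm_colPart, redB, redB]
  simp [fromBlocks_multiply, mul_fromCols, mul_stack, mul_omega₂]

theorem redB_add_forwardPert (A : Matrix (Fin n) (Fin n) 𝕜) (Y₁ U dU : Matrix (Fin r) (Fin n) 𝕜)
    (N₁ N₂ N₃ dN₁ dN₂ : Matrix (Fin n) (Fin n) 𝕜) (N₄ dN₄ : Matrix (Fin n) (Fin r) 𝕜) :
    redB A Y₁ U N₁ N₂ N₃ N₄ + forwardPert dU dN₁ dN₂ dN₄ =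
      redB A Y₁ (U + dU) (N₁ - dN₁) (N₂ - dN₂) N₃ (N₄ + dN₄) := by
  ext i j
  rcases i with (i | i | i) | i <;> rcases j with (j | j) | j | j <;>
    simp [redB, forwardPert] <;> ring

end Deflation

section Rearrangements

variable {𝕜 : Type*} {n r : ℕ} {ι κ : Type*}

theorem exists_stack_eq (hr : r ≤ n) (M : Matrix (Fin n) κ 𝕜) : ∃ X R, stack hr X R = M := by
  refine ⟨M.submatrix (stackEquiv hr ∘ Sum.inl) id, M.submatrix (stackEquiv hr ∘ Sum.inr) id, ?_⟩
  ext i j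
  obtain ⟨i, rfl⟩ := (stackEquiv hr).surjective i
  rcases i with i | i <;> simp [stack]

theorem permCols_permCols_symm (M : Matrix ι κ 𝕜) (π : Equiv.Perm κ) :
    permCols (permCols M π.symm) π = M := by
  ext i j
  simp [permCols]

theorem permCols_symm_permCols (M : Matrix ι κ 𝕜) (π : Equiv.Perm κ) :
    permCols (permCols M π) π.symm = M :=
  permCols_permCols_symm M π.symm

theorem permCols_add [Add 𝕜] (M N : Matrix ι κ 𝕜) (π : Equiv.Perm κ) :
    permCols (M + N) π = permCols M π + permCols N π :=
  rfl

theorem topRows_keepRows [RCLike 𝕜] (hr : r ≤ n) (M : Matrix (Fin n) κ 𝕜) :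
    topRows hr (keepRows r M) = topRows hr M := by
  ext i j
  simp [topRows, keepRows, splitEquiv]

theorem botRows_keepRows [RCLike 𝕜] (hr : r ≤ n) (M : Matrix (Fin n) κ 𝕜) :
    botRows hr (keepRows r M) = 0 := by
  ext i j
  simp [botRows, keepRows, splitEquiv]

end Rearrangements

section Blocks

variable {𝕜 : Type*} [RCLike 𝕜] {n r : ℕ} {ι κ μ : Type*} [Fintype ι] [Fintype μ]

theorem submatrix_mul_conjTranspose_submatrix [DecidableEq κ] {U : Matrix κ ι 𝕜} (hU : U * Uᴴ = 1)
    {ι₁ ι₂ : Type*} (e : ι₁ → κ) (f : ι₂ → κ) :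
    U.submatrix e id * (U.submatrix f id)ᴴ = (1 : Matrix κ κ 𝕜).submatrix e f := by
  rw [conjTranspose_submatrix, ← submatrix_mul _ _ _ _ _ Function.bijective_id, hU]

section Rows

variable {U : Matrix (Fin n) ι 𝕜} (hr : r ≤ n) (hU : U * Uᴴ = 1)
include hU

theorem topRows_mul_conjTranspose_topRows : topRows hr U * (topRows hr U)ᴴ = 1 :=
  (submatrix_mul_conjTranspose_submatrix hU _ _).trans
    (submatrix_one _ ((splitEquiv hr).injective.comp Sum.inl_injective))

theorem botRows_mul_conjTranspose_botRows : botRows hr U * (botRows hr U)ᴴ = 1 :=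
  (submatrix_mul_conjTranspose_submatrix hU _ _).trans
    (submatrix_one _ ((splitEquiv hr).injective.comp Sum.inr_injective))

theorem topRows_mul_conjTranspose_botRows : topRows hr U * (botRows hr U)ᴴ = 0 :=
  (submatrix_mul_conjTranspose_submatrix hU _ _).trans (by ext i j; simp [one_apply])

theorem botRows_mul_conjTranspose_topRows : botRows hr U * (topRows hr U)ᴴ = 0 :=
  (submatrix_mul_conjTranspose_submatrix hU _ _).trans (by ext i j; simp [one_apply])

end Rows

theorem conjTranspose_omega₁_mul_omega₁ (hr : r ≤ n) {U : Matrix ι (Fin n) 𝕜} (hU : Uᴴ * U = 1) :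
    (omega₁ hr U)ᴴ * omega₁ hr U = 1 := by
  have orthonormal := (submatrix_mul_conjTranspose_submatrix (U := Uᴴ)
    (by rwa [conjTranspose_conjTranspose]) _ _).trans
      (submatrix_one _ ((stackEquiv hr).injective.comp Sum.inl_injective))
  rwa [← conjTranspose_submatrix, conjTranspose_conjTranspose] at orthonormal

theorem colNorm_topRows_le (hr : r ≤ n) (M : Matrix (Fin n) κ 𝕜) (j : κ) :
    colNorm (topRows hr M) j ≤ colNorm M j :=
  colNorm_submatrix_le M ((splitEquiv hr).injective.comp Sum.inl_injective) j

theorem colNorm_botRows_le (hr : r ≤ n) (M : Matrix (Fin n) κ 𝕜) (j : κ) :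
    colNorm (botRows hr M) j ≤ colNorm M j :=
  colNorm_submatrix_le M ((splitEquiv hr).injective.comp Sum.inr_injective) j

theorem frobNorm_topRows_le (hr : r ≤ n) (M : Matrix (Fin n) ι 𝕜) :
    frobNorm (topRows hr M) ≤ frobNorm M :=
  frobNorm_submatrix_le M ((splitEquiv hr).injective.comp Sum.inl_injective) Function.injective_id

theorem frobNorm_botRows_le (hr : r ≤ n) (M : Matrix (Fin n) ι 𝕜) :
    frobNorm (botRows hr M) ≤ frobNorm M :=
  frobNorm_submatrix_le M ((splitEquiv hr).injective.comp Sum.inr_injective) Function.injective_id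

theorem frobNorm_omega₁_le (hr : r ≤ n) (M : Matrix ι (Fin n) 𝕜) :
    frobNorm (omega₁ hr M) ≤ frobNorm M :=
  frobNorm_submatrix_le M Function.injective_id ((stackEquiv hr).injective.comp Sum.inl_injective)

theorem frobNorm_omega₂_le (hr : r ≤ n) (M : Matrix ι (Fin n) 𝕜) :
    frobNorm (omega₂ hr M) ≤ frobNorm M :=
  frobNorm_submatrix_le M Function.injective_id ((stackEquiv hr).injective.comp Sum.inr_injective)

theorem colNorm_fromRows (M : Matrix ι κ 𝕜) (N : Matrix μ κ 𝕜) (j : κ) :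
    colNorm (fromRows M N) j = √(colNorm M j ^ 2 + colNorm N j ^ 2) := by
  rw [colNorm, colNorm, colNorm, Real.sq_sqrt (by positivity), Real.sq_sqrt (by positivity),
    Fintype.sum_sum_type]
  rfl

theorem colNorm_stack (hr : r ≤ n) (X : Matrix (Fin (n - r)) κ 𝕜) (R : Matrix (Fin r) κ 𝕜)
    (j : κ) : colNorm (stack hr X R) j = colNorm (fromRows X R) j := by
  rw [colNorm, colNorm, ← (stackEquiv hr).sum_comp]
  simp [stack]

end Blocks

section BackwardErrors

variable {𝕜 : Type*} [RCLike 𝕜] {n m r : ℕ} {ε : ℝ} {v : Fin n → Fin n → 𝕜} {τ : Fin n → ℝ}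

theorem FlHouseholderQR.exists_backward_error (hε : 0 ≤ ε) (hsmall : qrErr ε n ≤ 1 / 2)
    (hm : m ≤ n) {M T : Matrix (Fin n) (Fin n) 𝕜} {π : Equiv.Perm (Fin n)}
    (h : FlHouseholderQR ε m (permCols M π) v τ T) :
    ∃ dM, permCols (M + dM) π = householderProd v m * T ∧
      ∀ j, colNorm dM j ≤ qrErr ε n * colNorm M j := by
  refine ⟨permCols (householderProd v m * T) π.symm - M, ?_, fun j => ?_⟩
  · rw [add_sub_cancel, permCols_permCols_symm]
  · have columnwise := h.colNorm_sub_le_qrErr hε hsmall hm (π.symm j)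
    have column_eq : colNorm (permCols M π) (π.symm j) = colNorm M j :=
      congrArg (colNorm M) (π.apply_symm_apply j)
    rw [column_eq] at columnwise
    refine le_of_eq_of_le ?_ columnwise
    simp only [colNorm, permCols, Matrix.sub_apply, submatrix_apply, id, π.apply_symm_apply]

theorem exists_truncation_error {U F T : Matrix (Fin n) (Fin n) 𝕜} {π : Equiv.Perm (Fin n)}
    {thr : ℝ} (hthr : 0 ≤ thr) (hU : Uᴴ * U = 1) (hF : permCols F π = U * T)
    (hdiag : ∀ i j : Fin n, (j : ℕ) < r → j < i → T i j = 0)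
    (hdrop : ∀ i j : Fin n, (i : ℕ) < r → r ≤ (j : ℕ) →
      colNorm (T - keepRows r T) j ≤ thr * ‖T i i‖) (hT : r = 0 → T = 0) :
    ∃ ΔF, permCols (F + ΔF) π = U * keepRows r T ∧
      (∀ i j : Fin n, (i : ℕ) < r → r ≤ (j : ℕ) →
        colNorm (permCols ΔF π) j ≤ thr * colNorm (permCols F π) i) ∧
      (∀ i j : Fin n, (j : ℕ) < r → permCols ΔF π i j = 0) ∧ (r = 0 → ΔF = 0) := by
  have kept : ∀ i j : Fin n, (j : ℕ) < r → (keepRows r T - T) i j = 0 := fun i j hj => by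
    by_cases hi : (i : ℕ) < r
    · simp [keepRows, hi]
    · simp [keepRows, hi, hdiag i j hj (hj.trans_le (not_lt.1 hi))]
  refine ⟨permCols (U * (keepRows r T - T)) π.symm, ?_, fun i j hi hj => ?_, fun i j hj => ?_,
    fun h0 => ?_⟩
  · rw [permCols_add, permCols_permCols_symm, hF, Matrix.mul_sub, add_sub_cancel]
  · rw [permCols_permCols_symm, hF, colNorm_mul_of_isometry hU, colNorm_mul_of_isometry hU,
      colNorm_sub_rev]
    exact (hdrop i j hi hj).trans
      (mul_le_mul_of_nonneg_left (norm_apply_le_colNorm T i i) hthr)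
  · rw [permCols_permCols_symm, Matrix.mul_apply]
    exact Finset.sum_eq_zero fun l _ => by rw [kept l j hj, mul_zero]
  · have nothing_kept : keepRows r T - T = 0 := by
      ext i j
      simp [hT h0, keepRows]
    rw [nothing_kept, Matrix.mul_zero]
    rfl

theorem FlHouseholderQR.exists_backward_error_of_truncation (hε : 0 ≤ ε)
    (hsmall : qrErr ε n ≤ 1 / 2) {θ : ℝ} (hθ : 0 ≤ θ) (hm : m ≤ n)
    {M T : Matrix (Fin n) (Fin n) 𝕜} {π : Equiv.Perm (Fin n)}
    (h : FlHouseholderQR ε m (permCols M π) v τ T)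
    (hdrop : ∀ j, colNorm (T - keepRows r T) j ≤ θ * colNorm T j) :
    ∃ dM, permCols (M + dM) π = householderProd v m * keepRows r T ∧
      ∀ j, colNorm dM j ≤ (qrErr ε n + 2 * θ) * colNorm M j := by
  obtain ⟨dM, factorization, dM_le⟩ := h.exists_backward_error hε hsmall hm
  have hU := mem_unitaryGroup_iff'.1 (householderProd_mem_unitaryGroup v m)
  set U := householderProd v m
  refine ⟨permCols (U * keepRows r T) π.symm - M, ?_, fun j => ?_⟩
  · rw [add_sub_cancel, permCols_permCols_symm]
  have exact_eq : M + dM = permCols (U * T) π.symm := by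
    rw [← factorization, permCols_symm_permCols]
  have colNorm_T : colNorm T (π.symm j) ≤ 2 * colNorm M j := by
    have colNorm_eq : colNorm T (π.symm j) = colNorm (M + dM) j := by
      rw [← colNorm_mul_of_isometry hU, exact_eq]
      rfl
    have triangle := colNorm_le_add_sub (M + dM) M j
    rw [add_sub_cancel_left, ← colNorm_eq] at triangle
    nlinarith [dM_le j, colNorm_nonneg M j]
  have dropped : colNorm (permCols (U * keepRows r T) π.symm - (M + dM)) j ≤
      θ * (2 * colNorm M j) := by
    rw [exact_eq]
    change colNorm (U * keepRows r T - U * T) (π.symm j) ≤ _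
    rw [← Matrix.mul_sub, colNorm_mul_of_isometry hU, colNorm_sub_rev]
    exact (hdrop _).trans (mul_le_mul_of_nonneg_left colNorm_T hθ)
  have triangle := colNorm_sub_le_add (permCols (U * keepRows r T) π.symm) (M + dM) M j
  rw [add_sub_cancel_left] at triangle
  linarith [dM_le j]

theorem exists_product_backward_errors (hε : 0 ≤ ε) (hsmall : qrErr ε n ≤ 1 / 4) (hm : m ≤ n)
    (hv : ∀ k : Fin n, (k : ℕ) < m → IsReflector ε k (v k) (τ k))
    {Q M X : Matrix (Fin n) (Fin n) 𝕜} (hQ : FlFormQ ε m v τ Q)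
    (hX : FlMatMul ε Qᴴ M X ∨ FlApplyAdjoint ε m v τ M X) :
    ∃ δM ΔM, X = Qᴴ * (M + δM) ∧ X = (householderProd v m)ᴴ * (M + ΔM) ∧
      (∀ j, colNorm δM j ≤ 4 * qrErr ε n * colNorm M j) ∧
      ∀ j, colNorm ΔM j ≤ 4 * qrErr ε n * colNorm M j := by
  have near := hQ.frobNorm_sub_le_qrErr hε hm hv
  have near_adj : frobNorm (Qᴴ - (householderProd v m)ᴴ) ≤ qrErr ε n := by
    rwa [frobNorm_conjTranspose_sub]
  have hU := householderProd_mem_unitaryGroup v m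
  have hadj : (householderProd v m)ᴴᴴ * (householderProd v m)ᴴ = 1 :=
    mem_unitaryGroup_iff'.1 (Unitary.star_mem hU)
  have residual : ∀ j,
      colNorm (X - (householderProd v m)ᴴ * M) j ≤ 2 * qrErr ε n * colNorm M j := by
    intro j
    rcases hX with hX | hX
    · refine hX.colNorm_sub_le_qrErr hε (Fintype.card_fin n).le ?_ near_adj j
      rw [frobNorm_conjTranspose]
      exact frobNorm_le_sqrt_add_one hU (near.trans (by linarith))
    · nlinarith [hX.colNorm_sub_le_qrErr hε hm hv j, qrErr_nonneg hε n, colNorm_nonneg M j]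
  obtain ⟨δM, hδM, δM_le⟩ := exists_eq_mul_add_of_near_isometry hadj near_adj
    (by linarith) residual
  obtain ⟨ΔM, hΔM, ΔM_le⟩ := exists_eq_mul_add_of_near_isometry (δ := 0) hadj
    (Q := (householderProd v m)ᴴ) (by simp [frobNorm]) one_pos residual
  exact ⟨δM, ΔM, hδM, hΔM,
    fun j => by nlinarith [δM_le j, colNorm_nonneg δM j],
    fun j => by nlinarith [ΔM_le j, colNorm_nonneg M j, qrErr_nonneg hε n]⟩

end BackwardErrors

section ForwardErrors

variable {𝕜 : Type*} [RCLike 𝕜] {ι κ μ : Type*} [Fintype ι] [Fintype μ] [DecidableEq μ] {e : ℝ}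

theorem colNorm_sub_mul_le_of_isometry {W : Matrix ι μ 𝕜} (hW : Wᴴ * W = 1) {M : Matrix μ κ 𝕜}
    {N : Matrix ι κ 𝕜} {j : κ} (he : 0 ≤ e) (he' : e ≤ 1 / 2)
    (hN : colNorm (N - W * M) j ≤ e * colNorm M j) :
    colNorm (N - W * M) j ≤ 2 * e * colNorm N j := by
  have triangle := colNorm_le_add_sub (W * M) N j
  rw [colNorm_mul_of_isometry hW, colNorm_sub_rev] at triangle
  have colNorm_M : colNorm M j ≤ 2 * colNorm N j := by nlinarith [colNorm_nonneg M j]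
  nlinarith

theorem one_sub_le_specNorm [Fintype κ] [DecidableEq κ] [Nonempty μ] {W : Matrix ι μ 𝕜}
    {V : Matrix μ κ 𝕜} (hW : Wᴴ * W = 1) (hV : V * Vᴴ = 1) (N : Matrix ι κ 𝕜) :
    1 - frobNorm (N - W * V) ≤ specNorm N := by
  obtain ⟨i⟩ := ‹Nonempty μ›
  have norm_single : ‖(Pi.single i 1 : μ → 𝕜)‖₂ = 1 :=
    (PiLp.norm_single 2 (fun _ => 𝕜) i 1).trans norm_one
  set x : κ → 𝕜 := Vᴴ *ᵥ Pi.single i 1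
  have norm_x : ‖x‖₂ = 1 := by
    rw [norm_mulVec_of_isometry (by rwa [conjTranspose_conjTranspose]), norm_single]
  have norm_WVx : ‖(W * V) *ᵥ x‖₂ = 1 := by
    rw [mulVec_mulVec, Matrix.mul_assoc, hV, Matrix.mul_one, norm_mulVec_of_isometry hW,
      norm_single]
  have norm_Nx := norm_mulVec_le_specNorm N x
  have error := norm_mulVec_le (N - W * V) x
  have triangle := norm_le_norm_add_norm_sub (toLp 2 (N *ᵥ x)) (toLp 2 ((W * V) *ᵥ x))
  rw [← toLp_sub, ← sub_mulVec] at triangle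
  rw [norm_x, mul_one] at norm_Nx error
  linarith

theorem specNorm_sub_mul_le_of_isometry [Fintype κ] [DecidableEq κ] [Nonempty μ]
    {W : Matrix ι μ 𝕜} {V : Matrix μ κ 𝕜} {N : Matrix ι κ 𝕜} (hW : Wᴴ * W = 1) (hV : V * Vᴴ = 1)
    (he : e ≤ 1 / 2) (hN : frobNorm (N - W * V) ≤ e) :
    specNorm (N - W * V) ≤ 2 * e * specNorm N := by
  have error_nonneg := frobNorm_nonneg (N - W * V)
  nlinarith [one_sub_le_specNorm hW hV N, specNorm_le_frobNorm (N - W * V)]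

end ForwardErrors

section FirstStep

variable {𝕜 : Type*} [RCLike 𝕜] {n r : ℕ} {ε δ η thr : ℝ} {hr : r ≤ n}
  {C D E Q X Y U δC δD δE ΔC ΔD ΔE : Matrix (Fin n) (Fin n) 𝕜} {π : Equiv.Perm (Fin n)}
  {R : Matrix (Fin r) (Fin n) 𝕜}

/-- Backward errors of the first deflation step with respect to a unitary matrix `U` within `δ` of
the computed factor `Q`. The small errors `δC`, `δD` refer to `Q` itself, the capital ones to `U`;
`η` bounds all of them relative to the data, except for the truncation error `ΔE`, which is governed
by the rank threshold `thr`. -/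
structure FirstStepErrors (δ η thr : ℝ) (hr : r ≤ n) (C D E : Matrix (Fin n) (Fin n) 𝕜)
    (π : Equiv.Perm (Fin n)) (Q : Matrix (Fin n) (Fin n) 𝕜) (R : Matrix (Fin r) (Fin n) 𝕜)
    (X Y U δC δD δE ΔC ΔD ΔE : Matrix (Fin n) (Fin n) 𝕜) : Prop where
  unitary : U ∈ unitaryGroup (Fin n) 𝕜
  frobNorm_sub_le : frobNorm (Q - U) ≤ δ
  X_eq_computed : X = Qᴴ * (D + δD)
  X_eq : X = Uᴴ * (D + ΔD)
  Y_eq_computed : Y = Qᴴ * (C + δC)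
  Y_eq : Y = Uᴴ * (C + ΔC)
  colNorm_δC_le : ∀ j, colNorm δC j ≤ η * colNorm C j
  colNorm_ΔC_le : ∀ j, colNorm ΔC j ≤ η * colNorm C j
  colNorm_δD_le : ∀ j, colNorm δD j ≤ η * colNorm D j
  colNorm_ΔD_le : ∀ j, colNorm ΔD j ≤ η * colNorm D j
  colNorm_δE_le : ∀ j, colNorm δE j ≤ η * colNorm E j
  topRows_eq : topRows hr (Uᴴ * permCols (E + δE + ΔE) π) = R
  botRows_eq : botRows hr (Uᴴ * permCols (E + δE + ΔE) π) = 0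
  colNorm_truncation_le : ∀ i j : Fin n, (i : ℕ) < r → r ≤ (j : ℕ) →
    colNorm (permCols ΔE π) j ≤ thr * colNorm (permCols (E + δE) π) i
  truncation_apply_eq_zero : ∀ i j : Fin n, (j : ℕ) < r → permCols ΔE π i j = 0
  truncation_eq_zero : r = 0 → ΔE = 0

theorem ComputedFirstStep.exists_errors (hε : 0 ≤ ε) (hsmall : qrErr ε n ≤ 1 / 4)
    (hthr : 0 ≤ thr) (hη : 4 * qrErr ε n ≤ η) (h : ComputedFirstStep ε thr hr C D E π Q R X Y) :
    ∃ U δC δD δE ΔC ΔD ΔE,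
      FirstStepErrors (qrErr ε n) η thr hr C D E π Q R X Y U δC δD δE ΔC ΔD ΔE := by
  obtain ⟨m, v, τ, T, hrm, hm, hT, hQ, -, hdrop, hT0, rfl, hX, hY⟩ := h
  have hv := hT.isReflector_of_qrErr hε (hsmall.trans (by norm_num))
  have hU := householderProd_mem_unitaryGroup v m
  have isometry : (householderProd v m)ᴴ * householderProd v m = 1 := mem_unitaryGroup_iff'.1 hU
  have level := qrErr_nonneg hε n
  have weaken : ∀ {M N : Matrix (Fin n) (Fin n) 𝕜},
      (∀ j, colNorm M j ≤ 4 * qrErr ε n * colNorm N j) → ∀ j, colNorm M j ≤ η * colNorm N j :=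
    fun bound j => (bound j).trans (mul_le_mul_of_nonneg_right hη (colNorm_nonneg _ j))
  obtain ⟨δD, ΔD, X_eq_computed, X_eq, δD_le, ΔD_le⟩ :=
    exists_product_backward_errors hε hsmall hm hv hQ hX
  obtain ⟨δC, ΔC, Y_eq_computed, Y_eq, δC_le, ΔC_le⟩ :=
    exists_product_backward_errors hε hsmall hm hv hQ hY
  obtain ⟨δE, factorization, δE_le⟩ :=
    hT.exists_backward_error hε (hsmall.trans (by norm_num)) hm
  obtain ⟨ΔE, truncated, ΔE_le, ΔE_apply, ΔE_zero⟩ := exists_truncation_error hthr isometry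
    factorization (fun i j hj => hT.eq_zero_below_diagonal hm (hj.trans_le hrm)) hdrop hT0
  have kept : (householderProd v m)ᴴ * permCols (E + δE + ΔE) π = keepRows r T := by
    rw [truncated, ← Matrix.mul_assoc, isometry, Matrix.one_mul]
  refine ⟨householderProd v m, δC, δD, δE, ΔC, ΔD, ΔE, hU, hQ.frobNorm_sub_le_qrErr hε hm hv,
    X_eq_computed, X_eq, Y_eq_computed, Y_eq, weaken δC_le, weaken ΔC_le, weaken δD_le,
    weaken ΔD_le, weaken fun j => (δE_le j).trans ?_, ?_, ?_, ΔE_le, ΔE_apply, ΔE_zero⟩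
  · exact mul_le_mul_of_nonneg_right (by linarith) (colNorm_nonneg E j)
  · rw [kept, topRows_keepRows]
  · rw [kept, botRows_keepRows]

namespace FirstStepErrors

variable (h : FirstStepErrors δ η thr hr C D E π Q R X Y U δC δD δE ΔC ΔD ΔE)
include h

theorem conjTranspose_mul_self : Uᴴ * U = 1 := mem_unitaryGroup_iff'.1 h.unitary

theorem conjTranspose_isometry : Uᴴᴴ * Uᴴ = 1 :=
  mem_unitaryGroup_iff'.1 (Unitary.star_mem h.unitary)

theorem conjTranspose_coisometry : Uᴴ * Uᴴᴴ = 1 :=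
  mem_unitaryGroup_iff.1 (Unitary.star_mem h.unitary)

theorem topRows_mul_perturbed_eq : topRows hr Uᴴ * (E + δE + ΔE) = permCols R π.symm := by
  rw [← h.topRows_eq]
  exact (permCols_symm_permCols (topRows hr Uᴴ * (E + δE + ΔE)) π).symm

theorem botRows_mul_perturbed_eq : botRows hr Uᴴ * (E + δE + ΔE) = 0 := by
  rw [← permCols_symm_permCols (botRows hr Uᴴ * (E + δE + ΔE)) π]
  exact congrArg (permCols · π.symm) h.botRows_eq

theorem colNorm_secondMatrix_le (j : Fin n) :
    colNorm (secondMatrix hr π R X) j ≤ colNorm (fromRows (D + ΔD) (E + δE + ΔE)) j := by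
  have X_le : colNorm (botRows hr X) j ≤ colNorm (D + ΔD) j := by
    rw [← colNorm_mul_of_isometry h.conjTranspose_isometry (D + ΔD), ← h.X_eq]
    exact colNorm_botRows_le hr X j
  have R_le : colNorm (permCols R π.symm) j ≤ colNorm (E + δE + ΔE) j := by
    rw [← colNorm_mul_of_isometry h.conjTranspose_isometry (E + δE + ΔE),
      ← h.topRows_mul_perturbed_eq]
    exact colNorm_topRows_le hr (Uᴴ * (E + δE + ΔE)) j
  rw [secondMatrix, colNorm_stack, colNorm_fromRows, colNorm_fromRows]
  have X_nonneg := colNorm_nonneg (botRows hr X) j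
  have R_nonneg := colNorm_nonneg (permCols R π.symm) j
  gcongr

end FirstStepErrors

end FirstStep

section SecondStep

variable {𝕜 : Type*} [RCLike 𝕜] {n r r₂ : ℕ} {ε η θ : ℝ} {hr : r ≤ n}
  {Q X Y U Q₂ R₂ N₁ N₂ N₃ U₂ dN₁ dN₂ : Matrix (Fin n) (Fin n) 𝕜} {π π₂ : Equiv.Perm (Fin n)}
  {R Γ₂ dU : Matrix (Fin r) (Fin n) 𝕜} {Γ₁ : Matrix (Fin (n - r)) (Fin n) 𝕜}
  {N₄ dN₄ : Matrix (Fin n) (Fin r) 𝕜}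

/-- Errors of the second deflation step with respect to a unitary matrix `U₂` near the computed
factor `Q₂`, where `U` is the unitary matrix of the first step: `Γ₁`, `Γ₂` are the blocks of the
backward error of the second factorization, and `dU`, `dN₁`, `dN₂`, `dN₄` turn the stored blocks of
the reduced pencil into the exact ones. All are bounded at the level `η`. -/
structure SecondStepErrors (η : ℝ) (hr : r ≤ n) (π : Equiv.Perm (Fin n))
    (Q : Matrix (Fin n) (Fin n) 𝕜) (R : Matrix (Fin r) (Fin n) 𝕜)
    (X Y U : Matrix (Fin n) (Fin n) 𝕜) (π₂ : Equiv.Perm (Fin n))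
    (Q₂ R₂ N₁ N₂ N₃ : Matrix (Fin n) (Fin n) 𝕜) (N₄ : Matrix (Fin n) (Fin r) 𝕜)
    (U₂ : Matrix (Fin n) (Fin n) 𝕜) (Γ₁ : Matrix (Fin (n - r)) (Fin n) 𝕜)
    (Γ₂ dU : Matrix (Fin r) (Fin n) 𝕜) (dN₁ dN₂ : Matrix (Fin n) (Fin n) 𝕜)
    (dN₄ : Matrix (Fin n) (Fin r) 𝕜) : Prop where
  unitary : U₂ ∈ unitaryGroup (Fin n) 𝕜
  frobNorm_sub_le : frobNorm (Q₂ - U₂) ≤ η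
  R_eq : permCols R₂ π₂.symm = U₂ᴴ * (secondMatrix hr π R X + stack hr Γ₁ Γ₂)
  colNorm_Γ_le : ∀ j, colNorm (fromRows Γ₁ Γ₂) j ≤ η * colNorm (secondMatrix hr π R X) j
  topRows_add : topRows hr Qᴴ + dU = topRows hr Uᴴ
  N₁_sub : N₁ - dN₁ = omega₁ hr U₂ᴴ * botRows hr Y
  N₂_sub : N₂ - dN₂ = omega₁ hr U₂ᴴ * botRows hr Uᴴ
  N₃_eq_zero : N₃ = 0
  N₄_add : N₄ + dN₄ = -omega₂ hr U₂ᴴ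
  specNorm_dU_le : specNorm dU ≤ η
  specNorm_dN₄_le : specNorm dN₄ ≤ η
  colNorm_dN₁_le : ∀ j, colNorm dN₁ j ≤ η * colNorm N₁ j
  specNorm_dN₂_le : specNorm dN₂ ≤ η * specNorm N₂

theorem FlMatMul.specNorm_sub_le_qrErr {ι κ μ : Type*} [Fintype ι] [Fintype κ] [DecidableEq κ]
    [Fintype μ] [DecidableEq μ] (hε : 0 ≤ ε) (hsmall : qrErr ε n * (4 * √n + 6) ≤ 1)
    (hκ : Fintype.card κ ≤ n) {V W : Matrix ι κ 𝕜} {M Z : Matrix κ μ 𝕜} {N : Matrix ι μ 𝕜}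
    (hW : Wᴴ * W = 1) (hZ : Z * Zᴴ = 1) (hV : frobNorm V ≤ √n + 1) (hM : frobNorm M ≤ √n + 1)
    (hVW : frobNorm (V - W) ≤ qrErr ε n) (hMZ : frobNorm (M - Z) ≤ qrErr ε n)
    (h : FlMatMul ε V M N) :
    specNorm (N - W * Z) ≤ qrErr ε n * (4 * √n + 6) * specNorm N := by
  have level := qrErr_nonneg hε n
  have product : frobNorm (N - W * M) ≤ 2 * qrErr ε n * frobNorm M :=
    frobNorm_le_of_colNorm_le (by positivity) (h.colNorm_sub_le_qrErr hε hκ hV hVW)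
  rcases isEmpty_or_nonempty κ with _ | _
  · have M_zero : frobNorm M = 0 := by simp [frobNorm]
    rw [M_zero, mul_zero, Subsingleton.elim M Z] at product
    exact (specNorm_le_frobNorm _).trans
      (product.trans (mul_nonneg (by positivity) (specNorm_nonneg N)))
  · have error : frobNorm (N - W * Z) ≤ qrErr ε n * (2 * √n + 3) :=
      calc frobNorm (N - W * Z) ≤ frobNorm (N - W * M) + frobNorm (W * (M - Z)) := by
            rw [Matrix.mul_sub]
            exact frobNorm_sub_le_add N (W * M) (W * Z)
        _ ≤ 2 * qrErr ε n * (√n + 1) + qrErr ε n := by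
            rw [frobNorm_mul_of_isometry hW]
            gcongr
            exact product.trans (by gcongr)
        _ = qrErr ε n * (2 * √n + 3) := by ring
    exact (specNorm_sub_mul_le_of_isometry hW hZ (by linarith) error).trans_eq (by ring)

section Products

variable (hε : 0 ≤ ε) (hU₂ : U₂ ∈ unitaryGroup (Fin n) 𝕜) (near₂ : frobNorm (Q₂ - U₂) ≤ qrErr ε n)
include near₂

theorem frobNorm_omega₁_sub_le (hr : r ≤ n) :
    frobNorm (omega₁ hr Q₂ᴴ - omega₁ hr U₂ᴴ) ≤ qrErr ε n :=
  (frobNorm_omega₁_le hr (Q₂ᴴ - U₂ᴴ)).trans ((frobNorm_conjTranspose_sub Q₂ U₂).trans_le near₂)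

include hU₂

theorem frobNorm_omega₁_le_sqrt_add_one (hsmall : qrErr ε n ≤ 1) (hr : r ≤ n) :
    frobNorm (omega₁ hr Q₂ᴴ) ≤ √n + 1 :=
  (frobNorm_omega₁_le hr Q₂ᴴ).trans ((frobNorm_conjTranspose Q₂).trans_le
    (frobNorm_le_sqrt_add_one hU₂ (near₂.trans hsmall)))

include hε

theorem FlMatMul.colNorm_sub_omega₁_mul_le (hsmall : qrErr ε n ≤ 1 / 4)
    (h : FlMatMul ε (omega₁ hr Q₂ᴴ) (botRows hr Y) N₁) (j : Fin n) :
    colNorm (N₁ - omega₁ hr U₂ᴴ * botRows hr Y) j ≤ 4 * qrErr ε n * colNorm N₁ j := by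
  have level := qrErr_nonneg hε n
  have error := h.colNorm_sub_le_qrErr hε (by simp)
    (frobNorm_omega₁_le_sqrt_add_one hU₂ near₂ (by linarith) hr)
    (frobNorm_omega₁_sub_le near₂ hr) j
  exact (colNorm_sub_mul_le_of_isometry (conjTranspose_omega₁_mul_omega₁ hr
    (mem_unitaryGroup_iff'.1 (Unitary.star_mem hU₂)))
    (by positivity) (by linarith) error).trans_eq (by ring)

theorem FlMatMul.specNorm_sub_omega₁_mul_le (hsmall : qrErr ε n * (4 * √n + 6) ≤ 1)
    (hU : U ∈ unitaryGroup (Fin n) 𝕜) (near : frobNorm (Q - U) ≤ qrErr ε n)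
    (h : FlMatMul ε (omega₁ hr Q₂ᴴ) (botRows hr Qᴴ) N₂) :
    specNorm (N₂ - omega₁ hr U₂ᴴ * botRows hr Uᴴ) ≤
      qrErr ε n * (4 * √n + 6) * specNorm N₂ := by
  have level := qrErr_nonneg hε n
  have level_sqrt : 0 ≤ qrErr ε n * √n := by positivity
  refine h.specNorm_sub_le_qrErr hε hsmall (by simp) (conjTranspose_omega₁_mul_omega₁ hr
    (mem_unitaryGroup_iff'.1 (Unitary.star_mem hU₂)))
    (botRows_mul_conjTranspose_botRows hr (mem_unitaryGroup_iff.1 (Unitary.star_mem hU)))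
    (frobNorm_omega₁_le_sqrt_add_one hU₂ near₂ (by linarith) hr) ?_
    (frobNorm_omega₁_sub_le near₂ hr) ?_
  · refine (frobNorm_botRows_le hr Qᴴ).trans ?_
    rw [frobNorm_conjTranspose]
    exact frobNorm_le_sqrt_add_one hU (near.trans (by linarith))
  · exact (frobNorm_botRows_le hr (Qᴴ - Uᴴ)).trans ((frobNorm_conjTranspose_sub Q U).trans_le near)

end Products

theorem ComputedSecondStep.exists_errors (hε : 0 ≤ ε)
    (hsmall : qrErr ε n * (4 * √n + 6) ≤ 1) (hθ : 0 ≤ θ)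
    (hη : qrErr ε n * (4 * √n + 6) + 2 * θ ≤ η) (hU : U ∈ unitaryGroup (Fin n) 𝕜)
    (near : frobNorm (Q - U) ≤ qrErr ε n)
    (h : ComputedSecondStep ε θ hr r₂ π Q R X Y π₂ Q₂ R₂ N₁ N₂ N₃ N₄) :
    ∃ U₂ Γ₁ Γ₂ dU dN₁ dN₂ dN₄, SecondStepErrors η hr π Q R X Y U π₂ Q₂ R₂ N₁ N₂ N₃ N₄
      U₂ Γ₁ Γ₂ dU dN₁ dN₂ dN₄ := by
  obtain ⟨m, v, τ, T, -, hm, hT, hQ₂, -, hdrop, rfl, hN₁, hN₂, rfl, rfl⟩ := h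
  have level := qrErr_nonneg hε n
  have level_sqrt : 0 ≤ qrErr ε n * √n := by positivity
  have hU₂ := householderProd_mem_unitaryGroup v m
  have near₂ := hQ₂.frobNorm_sub_le_qrErr hε hm (hT.isReflector_of_qrErr hε (by linarith))
  obtain ⟨dM, factorization, dM_le⟩ :=
    hT.exists_backward_error_of_truncation hε (by linarith) hθ hm hdrop
  obtain ⟨Γ₁, Γ₂, rfl⟩ := exists_stack_eq hr dM
  set U₂ := householderProd v m
  have isometry : U₂ᴴ * U₂ = 1 := mem_unitaryGroup_iff'.1 hU₂
  refine ⟨U₂, Γ₁, Γ₂, topRows hr (Uᴴ - Qᴴ), N₁ - omega₁ hr U₂ᴴ * botRows hr Y,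
    N₂ - omega₁ hr U₂ᴴ * botRows hr Uᴴ, omega₂ hr (Q₂ᴴ - U₂ᴴ), hU₂, by linarith, ?_, fun j => ?_,
    add_sub_cancel _ _, sub_sub_cancel _ _, sub_sub_cancel _ _, rfl,
    (neg_add_eq_sub _ _).trans (sub_sub_cancel_left _ _), ?_, ?_, fun j => ?_, ?_⟩
  · calc permCols (keepRows r₂ T) π₂.symm
        = permCols (U₂ᴴ * permCols (secondMatrix hr π R X + stack hr Γ₁ Γ₂) π₂) π₂.symm := by
          rw [factorization, ← Matrix.mul_assoc, isometry, Matrix.one_mul]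
      _ = _ := permCols_symm_permCols (U₂ᴴ * (secondMatrix hr π R X + stack hr Γ₁ Γ₂)) π₂
  · rw [← colNorm_stack hr]
    exact (dM_le j).trans (mul_le_mul_of_nonneg_right (by linarith) (colNorm_nonneg _ j))
  · have error := frobNorm_topRows_le hr (Uᴴ - Qᴴ)
    rw [frobNorm_conjTranspose_sub, frobNorm_sub_rev] at error
    linarith [specNorm_le_frobNorm (topRows hr (Uᴴ - Qᴴ))]
  · have error := frobNorm_omega₂_le hr (Q₂ᴴ - U₂ᴴ)
    rw [frobNorm_conjTranspose_sub] at error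
    linarith [specNorm_le_frobNorm (omega₂ hr (Q₂ᴴ - U₂ᴴ))]
  · exact (hN₁.colNorm_sub_omega₁_mul_le hε hU₂ near₂ (by linarith) j).trans
      (mul_le_mul_of_nonneg_right (by linarith) (colNorm_nonneg _ j))
  · exact (hN₂.specNorm_sub_omega₁_mul_le hε hU₂ near₂ hsmall hU near).trans
      (mul_le_mul_of_nonneg_right (by linarith) (specNorm_nonneg _))

end SecondStep

section Pencils

variable {𝕜 : Type*} [RCLike 𝕜] {n r : ℕ} {δ η thr : ℝ} {hr : r ≤ n}
  {C D E Q X Y U δC δD δE ΔC ΔD ΔE Q₂ R₂ N₁ N₂ N₃ U₂ dN₁ dN₂ : Matrix (Fin n) (Fin n) 𝕜}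
  {π π₂ : Equiv.Perm (Fin n)} {R Γ₂ dU : Matrix (Fin r) (Fin n) 𝕜}
  {Γ₁ : Matrix (Fin (n - r)) (Fin n) 𝕜} {N₄ dN₄ : Matrix (Fin n) (Fin r) 𝕜}

namespace FirstStepErrors

variable (h : FirstStepErrors δ η thr hr C D E π Q R X Y U δC δD δE ΔC ΔD ΔE)
include h

theorem topRows_mul_absorbed_D (Γ₁ : Matrix (Fin (n - r)) (Fin n) 𝕜) :
    topRows hr (Uᴴ * (D + (ΔD + (botRows hr Uᴴ)ᴴ * Γ₁))) = topRows hr X := by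
  change topRows hr Uᴴ * (D + (ΔD + (botRows hr Uᴴ)ᴴ * Γ₁)) = _
  rw [← add_assoc, Matrix.mul_add, ← Matrix.mul_assoc,
    topRows_mul_conjTranspose_botRows hr h.conjTranspose_coisometry, Matrix.zero_mul, add_zero,
    h.X_eq]
  rfl

theorem botRows_mul_absorbed_D (Γ₁ : Matrix (Fin (n - r)) (Fin n) 𝕜) :
    botRows hr (Uᴴ * (D + (ΔD + (botRows hr Uᴴ)ᴴ * Γ₁))) = botRows hr X + Γ₁ := by
  change botRows hr Uᴴ * (D + (ΔD + (botRows hr Uᴴ)ᴴ * Γ₁)) = _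
  rw [← add_assoc, Matrix.mul_add, ← Matrix.mul_assoc,
    botRows_mul_conjTranspose_botRows hr h.conjTranspose_coisometry, Matrix.one_mul, h.X_eq]
  rfl

theorem topRows_mul_absorbed_E (Γ₂ : Matrix (Fin r) (Fin n) 𝕜) :
    topRows hr (Uᴴ * (E + (δE + ΔE + (topRows hr Uᴴ)ᴴ * Γ₂))) = permCols R π.symm + Γ₂ := by
  change topRows hr Uᴴ * (E + (δE + ΔE + (topRows hr Uᴴ)ᴴ * Γ₂)) = _
  rw [← add_assoc, ← add_assoc, Matrix.mul_add, ← Matrix.mul_assoc,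
    topRows_mul_conjTranspose_topRows hr h.conjTranspose_coisometry, Matrix.one_mul,
    h.topRows_mul_perturbed_eq]

theorem botRows_mul_absorbed_E (Γ₂ : Matrix (Fin r) (Fin n) 𝕜) :
    botRows hr (Uᴴ * (E + (δE + ΔE + (topRows hr Uᴴ)ᴴ * Γ₂))) = 0 := by
  change botRows hr Uᴴ * (E + (δE + ΔE + (topRows hr Uᴴ)ᴴ * Γ₂)) = _
  rw [← add_assoc, ← add_assoc, Matrix.mul_add, ← Matrix.mul_assoc,
    botRows_mul_conjTranspose_topRows hr h.conjTranspose_coisometry, Matrix.zero_mul, add_zero,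
    h.botRows_mul_perturbed_eq]

end FirstStepErrors

variable (h₁ : FirstStepErrors δ η thr hr C D E π Q R X Y U δC δD δE ΔC ΔD ΔE)
  (h₂ : SecondStepErrors η hr π Q R X Y U π₂ Q₂ R₂ N₁ N₂ N₃ N₄ U₂ Γ₁ Γ₂ dU dN₁ dN₂ dN₄)
include h₁ h₂

theorem deflationTransform_linA_eq_redA (B : Matrix (Fin n) (Fin n) 𝕜) :
    deflationTransform hr U U₂ (linA B (D + (ΔD + (botRows hr Uᴴ)ᴴ * Γ₁))
        (E + (δE + ΔE + (topRows hr Uᴴ)ᴴ * Γ₂))) =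
      fromBlocks (redA B (topRows hr X) (permCols R₂ π₂.symm))
        (fromRows 0 (-omega₁ hr U₂ᴴ)) 0 0 := by
  rw [deflationTransform_linA hr h₁.conjTranspose_mul_self U₂ B _ (h₁.botRows_mul_absorbed_E Γ₂),
    h₁.topRows_mul_absorbed_D, h₁.botRows_mul_absorbed_D, h₁.topRows_mul_absorbed_E, stack_add,
    h₂.R_eq, secondMatrix]

theorem deflationTransform_linB_eq_redB_add (A : Matrix (Fin n) (Fin n) 𝕜) :
    deflationTransform hr U U₂ (linB A (C + ΔC)) =
      fromBlocks (redB A (topRows hr Y) (topRows hr Qᴴ) N₁ N₂ N₃ N₄ +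
        forwardPert dU dN₁ dN₂ dN₄) 0 0 (-1) := by
  rw [deflationTransform_linB hr h₁.conjTranspose_mul_self U₂ A, ← h₁.Y_eq, redB_add_forwardPert,
    h₂.topRows_add, h₂.N₁_sub, h₂.N₂_sub, h₂.N₃_eq_zero, h₂.N₄_add]

end Pencils

section MildGrowth

theorem MildlyGrowing.monomial {c : ℝ} (hc : 0 ≤ c) (d : ℕ) :
    MildlyGrowing fun n => c * ((n : ℝ) + 1) ^ d :=
  ⟨c, d, fun _ => ⟨by positivity, le_rfl⟩⟩

theorem MildlyGrowing.nonneg {f : ℕ → ℝ} (hf : MildlyGrowing f) (n : ℕ) : 0 ≤ f n := by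
  obtain ⟨_, _, bounds⟩ := hf
  exact (bounds n).1

theorem MildlyGrowing.const_mul {a : ℝ} (ha : 0 ≤ a) {f : ℕ → ℝ} (hf : MildlyGrowing f) :
    MildlyGrowing fun n => a * f n := by
  obtain ⟨c, d, bounds⟩ := hf
  refine ⟨a * c, d, fun n => ⟨mul_nonneg ha (bounds n).1, ?_⟩⟩
  rw [mul_assoc]
  exact mul_le_mul_of_nonneg_left (bounds n).2 ha

theorem MildlyGrowing.add {f g : ℕ → ℝ} (hf : MildlyGrowing f) (hg : MildlyGrowing g) :
    MildlyGrowing fun n => f n + g n := by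
  obtain ⟨c, d, f_bounds⟩ := hf
  obtain ⟨c', d', g_bounds⟩ := hg
  refine ⟨|c| + |c'|, d + d', fun n => ⟨add_nonneg (f_bounds n).1 (g_bounds n).1, ?_⟩⟩
  have one_le : (1 : ℝ) ≤ n + 1 := by simp
  calc f n + g n ≤ c * (n + 1) ^ d + c' * (n + 1) ^ d' :=
        add_le_add (f_bounds n).2 (g_bounds n).2
    _ ≤ |c| * (n + 1) ^ (d + d') + |c'| * (n + 1) ^ (d + d') :=
        add_le_add
          (mul_le_mul (le_abs_self c) (pow_le_pow_right₀ one_le (by omega)) (by positivity)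
            (abs_nonneg c))
          (mul_le_mul (le_abs_self c') (pow_le_pow_right₀ one_le (by omega)) (by positivity)
            (abs_nonneg c'))
    _ = (|c| + |c'|) * (n + 1) ^ (d + d') := by ring

end MildGrowth

end QuarticDeflation

end

theorem mainTheorem2 {𝕜 : Type*} [RCLike 𝕜]
    (g : ℕ → ℝ) (hg : QuarticDeflation.MildlyGrowing g) :
    ∃ fC fD fqr f₁ f₂ h : ℕ → ℝ,
      QuarticDeflation.MildlyGrowing fC ∧ QuarticDeflation.MildlyGrowing fD ∧
      QuarticDeflation.MildlyGrowing fqr ∧ QuarticDeflation.MildlyGrowing f₁ ∧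
      QuarticDeflation.MildlyGrowing f₂ ∧ QuarticDeflation.MildlyGrowing h ∧
      ∀ (n r r₂ : ℕ) (hr : r ≤ n) (_hr₂ : r₂ ≤ n) (ε thr : ℝ) (_hε : 0 ≤ ε) (_hsmall : h n * ε ≤ 1)
        (_hthr : 0 ≤ thr)
        (A B C D E : Matrix (Fin n) (Fin n) 𝕜)
        -- computed quantities of the first step
        (πE : Equiv.Perm (Fin n)) (QE : Matrix (Fin n) (Fin n) 𝕜) (RE : Matrix (Fin r) (Fin n) 𝕜)
        (X Y : Matrix (Fin n) (Fin n) 𝕜)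
        -- computed quantities of the second step
        (π₂ : Equiv.Perm (Fin n)) (Q₂ R₂ N₁ N₂ N₃ : Matrix (Fin n) (Fin n) 𝕜)
        (N₄ : Matrix (Fin n) (Fin r) 𝕜)
        (_h₁ : QuarticDeflation.ComputedFirstStep ε thr hr C D E πE QE RE X Y)
        (_h₂ : QuarticDeflation.ComputedSecondStep ε (g n * ε) hr r₂ πE QE RE X Y π₂ Q₂ R₂
          N₁ N₂ N₃ N₄),
      -- exactly unitary matrices, backward errors, forward errors
      ∃ (QEhat Q₂hat δC δD δE ΔC ΔD ΔE DS ES : Matrix (Fin n) (Fin n) 𝕜)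
        (Γ₁ : Matrix (Fin (n - r)) (Fin n) 𝕜) (Γ₂ : Matrix (Fin r) (Fin n) 𝕜)
        (dU : Matrix (Fin r) (Fin n) 𝕜) (dN₁ dN₂ : Matrix (Fin n) (Fin n) 𝕜)
        (dN₄ : Matrix (Fin n) (Fin r) 𝕜)
        (S : Matrix (QuarticDeflation.RowIdx n r) (Fin (n - r)) 𝕜),
        QEhat ∈ Matrix.unitaryGroup (Fin n) 𝕜 ∧ Q₂hat ∈ Matrix.unitaryGroup (Fin n) 𝕜 ∧
        QuarticDeflation.frobNorm (QE - QEhat) ≤ fqr n * ε ∧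
        QuarticDeflation.frobNorm (Q₂ - Q₂hat) ≤ fqr n * ε ∧
        -- the backward errors of the first step
        X = QE.conjTranspose * (D + δD) ∧ X = QEhat.conjTranspose * (D + ΔD) ∧
        Y = QE.conjTranspose * (C + δC) ∧ Y = QEhat.conjTranspose * (C + ΔC) ∧
        (∀ i, QuarticDeflation.colNorm δC i ≤ fC n * ε * QuarticDeflation.colNorm C i) ∧
        (∀ i, QuarticDeflation.colNorm ΔC i ≤ fC n * ε * QuarticDeflation.colNorm C i) ∧
        (∀ i, QuarticDeflation.colNorm δD i ≤ fD n * ε * QuarticDeflation.colNorm D i) ∧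
        (∀ i, QuarticDeflation.colNorm ΔD i ≤ fD n * ε * QuarticDeflation.colNorm D i) ∧
        (∀ i, QuarticDeflation.colNorm δE i ≤ fqr n * ε * QuarticDeflation.colNorm E i) ∧
        QuarticDeflation.topRows hr
            (QEhat.conjTranspose * QuarticDeflation.permCols (E + δE + ΔE) πE) = RE ∧
        QuarticDeflation.botRows hr
            (QEhat.conjTranspose * QuarticDeflation.permCols (E + δE + ΔE) πE) = 0 ∧
        -- the truncation error of the first step
        (∀ i j : Fin n, (i : ℕ) < r → r ≤ (j : ℕ) →
          QuarticDeflation.colNorm (QuarticDeflation.permCols ΔE πE) j ≤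
            thr * QuarticDeflation.colNorm (QuarticDeflation.permCols (E + δE) πE) i) ∧
        (∀ i j : Fin n, (j : ℕ) < r → QuarticDeflation.permCols ΔE πE i j = 0) ∧
        (r = 0 → ΔE = 0) ∧
        -- the accumulated backward errors in `D` and `E`
        DS = ΔD + (QuarticDeflation.botRows hr QEhat.conjTranspose).conjTranspose * Γ₁ ∧
        ES = δE + ΔE + (QuarticDeflation.topRows hr QEhat.conjTranspose).conjTranspose * Γ₂ ∧
        (∀ i, QuarticDeflation.colNorm (Matrix.fromRows Γ₁ Γ₂) i ≤
          fqr n * ε * QuarticDeflation.colNorm (Matrix.fromRows (D + ΔD) (E + δE + ΔE)) i) ∧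
        -- the forward perturbation is small
        QuarticDeflation.specNorm dU ≤ fqr n * ε ∧
        QuarticDeflation.specNorm dN₄ ≤ fqr n * ε ∧
        (∀ i, QuarticDeflation.colNorm dN₁ i ≤ f₁ n * ε * QuarticDeflation.colNorm N₁ i) ∧
        QuarticDeflation.specNorm dN₂ ≤ f₂ n * ε * QuarticDeflation.specNorm N₂ ∧
        -- the computed pencil plus the forward perturbation is an exactly reduced linearization
        -- of the perturbed quartic
        QuarticDeflation.deflationTransform hr QEhat Q₂hat
            (QuarticDeflation.linA B (D + DS) (E + ES)) =
          Matrix.fromBlocks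
            (QuarticDeflation.redA B (QuarticDeflation.topRows hr X)
              (QuarticDeflation.permCols R₂ π₂.symm))
            S 0 0 ∧
        QuarticDeflation.deflationTransform hr QEhat Q₂hat
            (QuarticDeflation.linB A (C + ΔC)) =
          Matrix.fromBlocks
            (QuarticDeflation.redB A (QuarticDeflation.topRows hr Y)
                (QuarticDeflation.topRows hr QE.conjTranspose) N₁ N₂ N₃ N₄ +
              QuarticDeflation.forwardPert dU dN₁ dN₂ dN₄)
            0 0 (-1) := by
  have h_mild := QuarticDeflation.MildlyGrowing.monomial (c := 756) (by norm_num) 4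
  have f_mild := h_mild.add (hg.const_mul zero_le_two)
  refine ⟨_, _, _, _, _, _, f_mild, f_mild, f_mild, f_mild, f_mild, h_mild, ?_⟩
  intro n r r₂ hr _ ε thr hε hsmall hthr A B C D E πE QE RE X Y π₂ Q₂ R₂ N₁ N₂ N₃ N₄ h₁ h₂
  have hθ : 0 ≤ g n * ε := mul_nonneg (hg.nonneg n) hε
  have level_nonneg := QuarticDeflation.qrErr_nonneg hε n
  have level_sqrt := mul_nonneg level_nonneg (Real.sqrt_nonneg n)
  have level_le := QuarticDeflation.qrErr_mul_le hε hsmall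
  obtain ⟨U, δC, δD, δE, ΔC, ΔD, ΔE, H₁⟩ := h₁.exists_errors
    (η := (756 * ((n : ℝ) + 1) ^ 4 + 2 * g n) * ε) hε (by linarith) hthr (by linarith)
  obtain ⟨U₂, Γ₁, Γ₂, dU, dN₁, dN₂, dN₄, H₂⟩ := h₂.exists_errors
    (η := (756 * ((n : ℝ) + 1) ^ 4 + 2 * g n) * ε) hε (by linarith) hθ (by linarith)
    H₁.unitary H₁.frobNorm_sub_le
  exact ⟨U, U₂, δC, δD, δE, ΔC, ΔD, ΔE, _, _, Γ₁, Γ₂, dU, dN₁, dN₂, dN₄, _, H₁.unitary,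
    H₂.unitary, H₁.frobNorm_sub_le.trans (by linarith), H₂.frobNorm_sub_le, H₁.X_eq_computed,
    H₁.X_eq, H₁.Y_eq_computed, H₁.Y_eq, H₁.colNorm_δC_le, H₁.colNorm_ΔC_le, H₁.colNorm_δD_le,
    H₁.colNorm_ΔD_le, H₁.colNorm_δE_le, H₁.topRows_eq, H₁.botRows_eq, H₁.colNorm_truncation_le,
    H₁.truncation_apply_eq_zero, H₁.truncation_eq_zero, rfl, rfl,
    fun j => (H₂.colNorm_Γ_le j).trans
      (mul_le_mul_of_nonneg_left (H₁.colNorm_secondMatrix_le j) (by linarith)),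
    H₂.specNorm_dU_le, H₂.specNorm_dN₄_le, H₂.colNorm_dN₁_le, H₂.specNorm_dN₂_le,
    QuarticDeflation.deflationTransform_linA_eq_redA H₁ H₂ B,
    QuarticDeflation.deflationTransform_linB_eq_redB_add H₁ H₂ A⟩
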